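/- Consider a discrete-time load balancing system with $n\ge 1$ parallel queues. In each time slot $k$, given the vector $\boldsymbol q(k)\in\mathbb{N}^n$ of queue lengths, a number $a(k)$ of jobs arrives, all of them are routed to one queue $i^*(k)$, and then queue $i$ can serve up to $s_i(k)$ jobs: $$q_i(k+1)=\max\{q_i(k)+a(k)\mathbf 1_{\{i=i^*(k)\}}-s_i(k),\,0\}.$$ The vectors $\boldsymbol s(k)=(s_1(k),\dots,s_n(k))$ are i.i.d. over $k$ (the coordinates may be correlated), $\mathbb{N}^n$-valued, bounded by a constant $S_{\max}$, with rates $\mu_i=\mathbb{E}[s_i]>0$; put $\mu_\Sigma=\sum_{i=1}^n\mu_i$. For each $\epsilon\in(0,\mu_\Sigma)$ consider such a system with arrivals $a^{(\epsilon)}(k)$ that are i.i.d. over $k$, independent of the services and of the current queue lengths, $\mathbb{N}$-valued, bounded by a constant $A_{\max}$ not depending on $\epsilon$, with $\mathbb{E}[a^{(\epsilon)}]=\mu_\Sigma-\epsilon$ and variance $(\sigma_a^{(\epsilon)})^2$, where $\lim_{\epsilon\downarrow0}\sigma_a^{(\epsilon)}=\sigma_a$. The law of $\boldsymbol s$ does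 not depend on $\epsilon$. Routing is Join-the-Shortest-Queue: $i^*(k)\in\arg\min_i q_i^{(\epsilon)}(k)$, ties being broken at random (by any law on the set of shortest queues that depends only on the current queue lengths, independently of the arrivals and services of the slot). Then the following holds. 1. (Throughput optimality) For every $\epsilon\in(0,\mu_\Sigma)$ the Markov chain $\{\boldsymbol q^{(\epsilon)}(k)\}$ is positive recurrent (every state of a closed communicating class has a finite mean return time and, from every initial state, the union of these classes is entered in finite mean time), and it has a stationary distribution. For each $\epsilon\in(0,\mu_\Sigma)$ let $\overline{\boldsymbol q}^{(\epsilon)}$ be a steady-state queue length vector, that is, a random vector with a stationary distribution of the chain. Then moreover: 2. (State space collapse) Let $\boldsymbol y_\perp=\boldsymbol y-\boldsymbol y_\parallel$, where $\boldsymbol y_\parallel$ is the orthogonal projection of $\boldsymbol y\in\mathbb{R}^n$ on $\{\boldsymbol x:\ x_i=x_j\ \forall i,j\}$. Then $\mathbb{E}\big[\|\overline{\boldsymbol q}_\perp^{(\epsilon)}\|^2\big]$ is finite for every $\epsilon\in(0,\mu_\Sigma)$ and is $o(1/\epsilon^2)$ as $\epsilon\downarrow0$. 3. (Finite MGF) There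 is $\Theta>0$ such that $\mathbb{E}\big[e^{\theta\epsilon\sum_{i=1}^n\overline q_i^{(\epsilon)}}\big]<\infty$ for all $\theta\in[-\Theta,\Theta]$ and all $\epsilon\in(0,\mu_\Sigma)$. 4. (Heavy-traffic limit) As $\epsilon\downarrow0$, $\epsilon\,\overline{\boldsymbol q}^{(\epsilon)}$ converges in distribution to $\Upsilon\boldsymbol 1$, where $\boldsymbol 1=(1,\dots,1)$ and $\Upsilon$ is an exponential random variable with mean $$\frac1{2n}\Big(\sigma_a^2+\sum_{i=1}^n\sum_{j=1}^n\mathrm{Cov}[s_i,s_j]\Big)$$ (if this number is $0$, then $\Upsilon=0$). -/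

import Mathlib

open MeasureTheory ProbabilityTheory Filter Topology Set
open scoped ENNReal

/-! ### Time-homogeneous Markov chains on a discrete state space

A chain is given by its one-step transition law `P : S → PMF S`. -/

namespace MarkovChain

variable {S : Type*}

/-- `π` is a stationary (steady-state) distribution of the chain: if `X(k)` has law `π`, then so
has `X(k+1)`. -/
def IsStationary (P : S → PMF S) (π : PMF S) : Prop := π.bind P = π

/-- `y` can be reached from `x` in finitely many (possibly zero) steps of positive probability. -/
def Reachable (P : S → PMF S) (x y : S) : Prop :=
  Relation.ReflTransGen (fun u v => v ∈ (P u).support) x y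

/-- `x` belongs to a closed communicating class: the chain can come back to `x` from every state
that it can reach from `x`. In an irreducible chain every state is essential. -/
def IsEssential (P : S → PMF S) (x : S) : Prop :=
  ∀ y, Reachable P x y → Reachable P y x

/-- The probability that the chain started at `x` is outside `A` at each of the times
`1, …, k`, that is, `ℙ_x(T_A > k)` for `T_A = inf {k ≥ 1 : X(k) ∈ A}`. -/
noncomputable def avoidProb (P : S → PMF S) (A : Set S) : ℕ → S → ℝ≥0∞
  | 0, _ => 1
  | k + 1, x => ∑' y, Aᶜ.indicator (fun y => P x y * avoidProb P A k y) y

/-- The expectation `𝔼_x[T_A] = ∑_{k ≥ 0} ℙ_x(T_A > k)` of the time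
`T_A = inf {k ≥ 1 : X(k) ∈ A}`, for the chain started at `x` (infinite if `A` is avoided forever
with positive probability). -/
noncomputable def meanHittingTime (P : S → PMF S) (A : Set S) (x : S) : ℝ≥0∞ :=
  ∑' k, avoidProb P A k x

/-- Positive recurrence. Every state of a closed communicating class has a finite mean return
time, and from every initial state the chain enters a closed communicating class in finite mean
time. If the chain is irreducible, this says that every state is positive recurrent. -/
def IsPositiveRecurrent (P : S → PMF S) : Prop :=
  (∀ x, IsEssential P x → meanHittingTime P {x} x < ∞) ∧
    ∀ x, meanHittingTime P {y | IsEssential P y} x < ∞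

end MarkovChain

/-! ### The load balancing system -/

namespace LoadBalancing

variable {n : ℕ}

/-- A routing policy, which sends all the arrivals of a time slot to one queue: given the queue
lengths `q`, the law of the index of that queue. -/
abbrev Routing (n : ℕ) : Type := (Fin n → ℕ) → PMF (Fin n)

/-- Join-the-Shortest-Queue: the selected queue is always a shortest one; ties are broken at
random, with an arbitrary law on the set of shortest queues. -/
def IsJSQ (route : Routing n) : Prop :=
  ∀ q, ∀ i ∈ (route q).support, ∀ j, q i ≤ q j

/-- One time slot of the queue length process. Given the queue lengths `q`, the selected queue `i`,
the number `a` of arrivals and the vector `s` of potential services are independent, and the new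
queue lengths are `max {q_j + a_j - s_j, 0}` (the subtraction of `ℕ` is truncated at `0`), where
`a_i = a` and `a_j = 0` for `j ≠ i`. The potential services of different queues in a time slot may
be correlated: `service` is their joint law. -/
noncomputable def step (service : PMF (Fin n → ℕ)) (arrival : PMF ℕ) (route : Routing n)
    (q : Fin n → ℕ) : PMF (Fin n → ℕ) :=
  (route q).bind fun i => arrival.bind fun a => service.bind fun s =>
    PMF.pure fun j => q j + (if j = i then a else 0) - s j

/-- `μ_i = 𝔼[s_i]`. -/
noncomputable def serviceRate (service : PMF (Fin n → ℕ)) (i : Fin n) : ℝ :=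
  ∫ s, (s i : ℝ) ∂service.toMeasure

/-- `μ_Σ = ∑_i μ_i`. -/
noncomputable def totalRate (service : PMF (Fin n → ℕ)) : ℝ := ∑ i, serviceRate service i

/-- `Cov[s_i, s_j]`. -/
noncomputable def serviceCov (service : PMF (Fin n → ℕ)) (i j : Fin n) : ℝ :=
  cov[fun s : Fin n → ℕ => (s i : ℝ), fun s => (s j : ℝ); service.toMeasure]

/-- The mean number of arrivals in a time slot. -/
noncomputable def arrivalRate (arrival : PMF ℕ) : ℝ := ∫ a, (a : ℝ) ∂arrival.toMeasure

/-- The standard deviation of the number of arrivals in a time slot. -/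
noncomputable def arrivalStd (arrival : PMF ℕ) : ℝ :=
  √(Var[fun a : ℕ => (a : ℝ); arrival.toMeasure])

/-- Queue lengths as a vector of the Euclidean space `ℝⁿ`. -/
noncomputable def toVec (q : Fin n → ℕ) : EuclideanSpace ℝ (Fin n) :=
  WithLp.toLp 2 fun i => (q i : ℝ)

/-- The vector `(1, …, 1)`. -/
noncomputable def oneVec (n : ℕ) : EuclideanSpace ℝ (Fin n) := WithLp.toLp 2 fun _ => 1

/-- The line of the vectors with equal coordinates. -/
def diagonal (n : ℕ) : Submodule ℝ (EuclideanSpace ℝ (Fin n)) where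
  carrier := {x | ∀ i j, x i = x j}
  add_mem' hx hy i j := by simp [hx i j, hy i j]
  zero_mem' _ _ := rfl
  smul_mem' c x hx i j := by simp [hx i j]

/-- `y_⊥ = y - y_∥`, where `y_∥` is the orthogonal projection of `y` on the diagonal. -/
noncomputable def perp (y : EuclideanSpace ℝ (Fin n)) : EuclideanSpace ℝ (Fin n) :=
  y - (diagonal n).starProjection y

/-- The law of an exponential random variable of mean `m ≥ 0`; for `m = 0` it is the point mass
at `0`. -/
noncomputable def expLaw (m : ℝ) : Measure ℝ :=
  if 0 < m then expMeasure m⁻¹ else Measure.dirac 0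

instance expLaw.instIsProbabilityMeasure (m : ℝ) : IsProbabilityMeasure (expLaw m) := by
  unfold expLaw
  split_ifs with h
  · exact isProbabilityMeasure_expMeasure (inv_pos.mpr h)
  · infer_instance

/-- State space collapse for a family of steady states `π ε`, `0 < ε < b`:
`𝔼[‖q̄_⊥^(ε)‖²]` is finite and is `o(1/ε²)` as `ε ↓ 0`. -/
def StateSpaceCollapse (b : ℝ) (π : ℝ → PMF (Fin n → ℕ)) : Prop :=
  (∀ ε ∈ Ioo 0 b, Integrable (fun q => ‖perp (toVec q)‖ ^ 2) (π ε).toMeasure) ∧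
    (fun ε => ∫ q, ‖perp (toVec q)‖ ^ 2 ∂(π ε).toMeasure) =o[𝓝[>] 0] fun ε : ℝ => 1 / ε ^ 2

/-- Existence of the moment generating function of `ε ∑_i q̄_i^(ε)` on an interval `[-Θ, Θ]`, for a
family of steady states `π ε`, `0 < ε < b`; the interval does not depend on `ε`. -/
def FiniteMGF (b : ℝ) (π : ℝ → PMF (Fin n → ℕ)) : Prop :=
  ∃ Θ : ℝ, 0 < Θ ∧ ∀ ε ∈ Ioo 0 b, ∀ θ ∈ Icc (-Θ) Θ,
    Integrable (fun q : Fin n → ℕ => Real.exp (θ * ε * ∑ i, (q i : ℝ))) (π ε).toMeasure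

end LoadBalancing

/-! Everything rests on drift (Lyapunov) arguments and on one exact balance equation in steady
state. Write `K = jumpSq n Amax Smax`, and let `j₀` be a shortest queue.

Under JSQ the arrivals are multiplied by the shortest length in the drift of `‖q‖²`, so that drift
is at most `K - 2ε q_{j₀} - 2 ∑ μ_j (q_j - q_{j₀})` (`integral_norm_sq_next_le`). Long queues thus
have negative drift, and Foster's criterion gives positive recurrence; a stationary law comes from
the mean occupation of an excursion from an essential state. Since jumps are bounded, `exp (η ‖q‖)`
is also a Lyapunov function for `η` of order `ε`, which gives the generating function
(`integrable_exp_norm_toVec`).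

For the collapse, subtract the drift of `(∑ q_i)² / n`: the terms in `ε q_{j₀}` cancel, and what
remains pulls towards the diagonal at a rate that does not vanish with `ε`. The Lyapunov function
`‖q_⊥‖⁴` then bounds `𝔼‖q̄_⊥‖²` uniformly near `ε = 0` (`integral_norm_sq_perp_le`).

For the limit, let `N` be the total after a slot, `U` the unused service of the slot and `φ` the
characteristic function of the steady-state total. Total plus net input equals `N - U`, and the net
input is independent of the current total. Service is wasted only when some queue ends empty, so `N
U ≤ 2n ‖q_⊥‖ U`, with `q_⊥` taken after the slot, and the collapse makes this negligible: `𝔼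
e^{ix(N-U)} ≈ φ(x) - ix 𝔼U`, where `𝔼U = ε`. At `x = τε`, a second-order expansion of the net input
and division by `ε²` give `φ · (iτ + τ² v / 2) → iτ` (`norm_integral_phase_mul_sub_le`), where `v`
is the limiting variance. So `φ` tends to `1 / (1 - iτ v / 2)`, an exponential characteristic
function. The collapse and Lévy's theorem upgrade this to vectors. -/

namespace MarkovChain

variable {S : Type*}

/-! ### Hitting times and Foster's criterion. -/

theorem avoidProb_le_one (P : S → PMF S) (A : Set S) (k : ℕ) (x : S) :
    avoidProb P A k x ≤ 1 := by
  induction k generalizing x with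
  | zero => exact le_rfl
  | succ k ih =>
    calc avoidProb P A (k + 1) x ≤ ∑' y, P x y := by
          refine ENNReal.tsum_le_tsum fun y => ?_
          refine (indicator_le_self' (fun _ _ => zero_le) y).trans ?_
          exact (mul_le_mul_right (ih y) _).trans (by simp)
      _ = 1 := (P x).tsum_coe

theorem avoidProb_antitone (P : S → PMF S) (A : Set S) (x : S) :
    Antitone fun k => avoidProb P A k x := by
  refine antitone_nat_of_succ_le fun k => ?_
  induction k generalizing x with
  | zero => exact avoidProb_le_one P A 1 x
  | succ k ih =>
    refine ENNReal.tsum_le_tsum fun y => indicator_le_indicator ?_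
    exact mul_le_mul_right (ih y) _

/-- A supersolution of the equation of the mean hitting time bounds the mean hitting time. -/
theorem meanHittingTime_le {P : S → PMF S} {A D : Set S} {f : S → ℝ≥0∞}
    (hD : ∀ x ∈ D, (P x).support ⊆ D)
    (hf : ∀ x ∈ D, 1 + ∑' y, Aᶜ.indicator (fun y => P x y * f y) y ≤ f x) {x : S} (hx : x ∈ D) :
    meanHittingTime P A x ≤ f x := by
  have key : ∀ N, ∀ x ∈ D, ∑ k ∈ Finset.range N, avoidProb P A k x ≤ f x := by
    intro N
    induction N with
    | zero => simp
    | succ N ih =>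
      intro x hx
      refine le_trans ?_ (hf x hx)
      rw [Finset.sum_range_succ', add_comm]
      refine add_le_add le_rfl ?_
      simp only [avoidProb]
      rw [← Summable.tsum_finsetSum fun _ _ => ENNReal.summable]
      refine ENNReal.tsum_le_tsum fun y => ?_
      by_cases hy : y ∈ Aᶜ
      · simp only [indicator_of_mem hy, ← Finset.mul_sum]
        -- The induction hypothesis is available only on `D`; states outside `D` carry no mass.
        by_cases hP : P x y = 0
        · simp [hP]
        · exact mul_le_mul_right (ih y (hD x hx hP)) _
      · simp [indicator_of_notMem hy]
  rw [meanHittingTime, ENNReal.tsum_eq_iSup_nat]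
  exact iSup_le fun N => key N x hx

/-- A single atom `w` suffices to lose mass, either because it is killed in `A` or because its
weight is below `1`. -/
theorem tsum_indicator_lt_one {p : PMF S} {A : Set S} {g : S → ℝ≥0∞} (hg : ∀ y, g y ≤ 1) {w : S}
    (hw : w ∈ p.support) (h : w ∈ A ∨ g w < 1) :
    ∑' y, Aᶜ.indicator (fun y => p y * g y) y < 1 := by
  have hle : ∀ y, Aᶜ.indicator (fun y => p y * g y) y ≤ p y := fun y =>
    (indicator_le_self' (fun _ _ => zero_le) y).trans
      ((mul_le_mul_right (hg y) _).trans (by simp))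
  rw [← p.tsum_coe]
  refine ENNReal.tsum_lt_tsum (i := w) ?_ hle ?_
  · exact ne_top_of_le_ne_top (by simp [p.tsum_coe]) (ENNReal.tsum_le_tsum hle)
  · have h0 : p w ≠ 0 := hw
    by_cases hA : w ∈ A
    · simpa [hA] using pos_iff_ne_zero.mpr h0
    · have hgw := h.resolve_left hA
      rw [indicator_of_mem (by simpa using hA)]
      simpa using ENNReal.mul_lt_mul_right h0 (p.apply_ne_top w) hgw

/-- Induction along a path to `A`. The first step `y → w` is separate because hitting is counted
from time `1`: starting in `A` does not count. -/
theorem exists_avoidProb_lt_one {P : S → PMF S} {A : Set S} {y w a : S} (hw : w ∈ (P y).support)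
    (hr : Reachable P w a) (ha : a ∈ A) : ∃ k, avoidProb P A k y < 1 := by
  induction hr using Relation.ReflTransGen.head_induction_on generalizing y with
  | refl => exact ⟨1, tsum_indicator_lt_one (avoidProb_le_one P A 0) hw (.inl ha)⟩
  | head h _ ih =>
    obtain ⟨k, hk⟩ := ih h
    exact ⟨k + 1, tsum_indicator_lt_one (avoidProb_le_one P A k) hw (.inr hk)⟩

theorem reachable_of_meanHittingTime_lt_top {P : S → PMF S} {A : Set S} {x : S}
    (h : meanHittingTime P A x < ∞) : ∃ a ∈ A, Reachable P x a := by
  by_contra! hcon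
  have key : ∀ k y, Reachable P x y → avoidProb P A k y = 1 := by
    intro k
    induction k with
    | zero => intros; rfl
    | succ k ih =>
      intro y hy
      rw [avoidProb, ← (P y).tsum_coe]
      refine tsum_congr fun z => ?_
      by_cases hz : P y z = 0
      · simp [hz]
      · have hxz : Reachable P x z := hy.tail hz
        rw [indicator_of_mem (show z ∈ Aᶜ from fun hzA => hcon z hzA hxz), ih z hxz, mul_one]
  simp only [meanHittingTime, key _ x .refl, ENNReal.tsum_const] at h
  simp at h

/-- **Foster's criterion**: a Lyapunov function whose drift is at most `-1` outside of a finite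
set `B` gives finite mean hitting times of each set `A` that can be reached from everywhere. -/
theorem meanHittingTime_lt_top_of_drift {P : S → PMF S} {A D : Set S} {V : S → ℝ≥0∞} {b : ℝ≥0∞}
    {B : Set S} (hB : B.Finite) (hb : b ≠ ∞) (hV : ∀ x, V x ≠ ∞)
    (hdrift : ∀ x, ∑' y, P x y * V y + 1 ≤ V x + B.indicator (fun _ => b) x)
    (hD : ∀ x ∈ D, (P x).support ⊆ D) (hA : ∀ x ∈ D, ∃ a ∈ A, Reachable P x a) {x : S}
    (hx : x ∈ D) : meanHittingTime P A x < ∞ := by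
  have hex : ∀ y ∈ D, ∃ k, avoidProb P A k y < 1 := fun y hy => by
    obtain ⟨w, hw⟩ := (P y).support_nonempty
    obtain ⟨a, ha, hr⟩ := hA w (hD y hy hw)
    exact exists_avoidProb_lt_one hw hr ha
  choose! k hk using hex
  -- Finiteness of `B` and monotonicity in time give one horizon `N` for all of `B ∩ D`.
  obtain ⟨N, hN⟩ : ∃ N, ∀ y ∈ B ∩ D, avoidProb P A N y < 1 := by
    obtain ⟨N, hN⟩ := ((hB.inter_of_left D).image k).bddAbove
    exact ⟨N, fun y hy => (avoidProb_antitone P A y (hN (mem_image_of_mem k hy))).trans_lt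
      (hk y hy.2)⟩
  obtain ⟨c, hc, hcb⟩ : ∃ c : ℝ≥0∞, c ≠ ∞ ∧ ∀ y ∈ B ∩ D, b ≤ c * (1 - avoidProb P A N y) := by
    refine ⟨∑ y ∈ (hB.inter_of_left D).toFinset, b / (1 - avoidProb P A N y), ?_, ?_⟩
    · refine (ENNReal.sum_lt_top.2 fun y hy => ?_).ne
      refine ENNReal.div_lt_top hb ?_
      exact (tsub_pos_of_lt (hN y (by simpa using hy))).ne'
    · intro y hy
      have h0 : 1 - avoidProb P A N y ≠ 0 := (tsub_pos_of_lt (hN y hy)).ne'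
      have h1 : 1 - avoidProb P A N y ≠ ∞ := by simp
      calc b = b / (1 - avoidProb P A N y) * (1 - avoidProb P A N y) :=
            (ENNReal.div_mul_cancel h0 h1).symm
        _ ≤ _ := by
            gcongr
            exact Finset.single_le_sum (f := fun y => b / (1 - avoidProb P A N y))
              (fun _ _ => zero_le) (by simpa using hy)
  -- The sum is `𝔼_y[min (T_A, N)]`. Its one-step drift telescopes to `-(1 - avoidProb P A N y)`,
  -- and `c` is large enough for this gain to pay for `b` on `B`, so `f` is a supersolution.
  set f : S → ℝ≥0∞ := fun y => V y + c * ∑ j ∈ Finset.range N, avoidProb P A j y with hfdef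
  have hfin : ∀ y, c * ∑ j ∈ Finset.range N, avoidProb P A j y ≠ ∞ := fun y =>
    ENNReal.mul_ne_top hc (ENNReal.sum_ne_top.2 fun j _ =>
      ne_top_of_le_ne_top ENNReal.one_ne_top (avoidProb_le_one P A j y))
  refine (meanHittingTime_le (f := f) hD (fun y hy => ?_) hx).trans_lt
    (ENNReal.add_lt_top.2 ⟨(hV x).lt_top, (hfin x).lt_top⟩)
  have h1 : ∑' z, Aᶜ.indicator (fun z => P y z * f z) z ≤
      ∑' z, P y z * V z + c * ∑ j ∈ Finset.range N, avoidProb P A (j + 1) y := by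
    have : ∀ z, Aᶜ.indicator (fun z => P y z * f z) z ≤ P y z * V z +
        c * ∑ j ∈ Finset.range N, Aᶜ.indicator (fun z => P y z * avoidProb P A j z) z := by
      intro z
      by_cases hz : z ∈ Aᶜ
      · simp only [indicator_of_mem hz, hfdef, ← Finset.mul_sum]
        rw [mul_add, mul_left_comm]
      · simp [indicator_of_notMem hz]
    refine (ENNReal.tsum_le_tsum this).trans ?_
    rw [ENNReal.tsum_add, ENNReal.tsum_mul_left,
      Summable.tsum_finsetSum fun _ _ => ENNReal.summable]
    rfl
  have h2 : ∑ j ∈ Finset.range N, avoidProb P A (j + 1) y + 1 =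
      ∑ j ∈ Finset.range N, avoidProb P A j y + avoidProb P A N y := by
    rw [← Finset.sum_range_succ, Finset.sum_range_succ']; rfl
  have hu := avoidProb_le_one P A N y
  have h3 : c * ∑ j ∈ Finset.range N, avoidProb P A (j + 1) y + c * (1 - avoidProb P A N y) ≤
      c * ∑ j ∈ Finset.range N, avoidProb P A j y := by
    rw [← mul_add]
    gcongr
    refine ENNReal.le_of_add_le_add_right (ne_top_of_le_ne_top ENNReal.one_ne_top hu) ?_
    rw [add_assoc, tsub_add_cancel_of_le hu, h2]
  have h4 : B.indicator (fun _ => b) y ≤ c * (1 - avoidProb P A N y) := by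
    by_cases hyB : y ∈ B
    · rw [indicator_of_mem hyB]; exact hcb y ⟨hyB, hy⟩
    · simp [indicator_of_notMem hyB]
  have h5 : c * (1 - avoidProb P A N y) ≠ ∞ := ENNReal.mul_ne_top hc (by simp)
  -- The gain is added to both sides, since subtraction in `ℝ≥0∞` is truncated.
  refine ENNReal.le_of_add_le_add_right h5 ?_
  calc 1 + ∑' z, Aᶜ.indicator (fun z => P y z * f z) z + c * (1 - avoidProb P A N y)
      ≤ (∑' z, P y z * V z + 1) + (c * ∑ j ∈ Finset.range N, avoidProb P A (j + 1) y
          + c * (1 - avoidProb P A N y)) := by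
        refine (add_le_add (add_le_add le_rfl h1) le_rfl).trans_eq (by ring)
    _ ≤ (V y + c * (1 - avoidProb P A N y)) + c * ∑ j ∈ Finset.range N, avoidProb P A j y :=
        add_le_add ((hdrift y).trans (add_le_add le_rfl h4)) h3
    _ = f y + c * (1 - avoidProb P A N y) := by simp only [hfdef]; ring

/-- Among the states of `B` reachable from `x`, take `z` from which the fewest states of `B` are
reachable. Whatever `z` reaches leads back to some `b ∈ B`; by minimality `b` reaches the same part
of `B` as `z`, hence `z` itself. -/
theorem exists_isEssential_reachable {P : S → PMF S} {B : Set S} (hB : B.Finite)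
    (hhit : ∀ x, ∃ y ∈ B, Reachable P x y) (x : S) : ∃ z, IsEssential P z ∧ Reachable P x z := by
  obtain ⟨z, hz, hmin⟩ : ∃ z ∈ {y ∈ B | Reachable P x y}, ∀ w ∈ {y ∈ B | Reachable P x y},
      ({u ∈ B | Reachable P z u}).ncard ≤ ({u ∈ B | Reachable P w u}).ncard := by
    obtain ⟨y, hy, hxy⟩ := hhit x
    exact (hB.sep _).exists_minimalFor (fun w => ({u ∈ B | Reachable P w u}).ncard) _ ⟨y, hy, hxy⟩
      |>.imp fun z hz => ⟨hz.1, fun w hw => (le_total _ _).elim (fun h => h) fun h => hz.2 hw h⟩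
  refine ⟨z, fun w hzw => ?_, hz.2⟩
  obtain ⟨b, hb, hwb⟩ := hhit w
  have hzb : Reachable P z b := hzw.trans hwb
  have hsub : {u ∈ B | Reachable P b u} ⊆ {u ∈ B | Reachable P z u} :=
    fun u hu => ⟨hu.1, hzb.trans hu.2⟩
  have heq := Set.eq_of_subset_of_ncard_le hsub (hmin b ⟨hb, hz.2.trans hzb⟩) (hB.sep _)
  have hzmem : z ∈ {u ∈ B | Reachable P b u} := heq ▸ ⟨hz.1, .refl⟩
  exact hwb.trans hzmem.2

theorem isPositiveRecurrent_of_drift {P : S → PMF S} {V : S → ℝ≥0∞} {b : ℝ≥0∞} {B : Set S}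
    (hB : B.Finite) (hb : b ≠ ∞) (hV : ∀ x, V x ≠ ∞)
    (hdrift : ∀ x, ∑' y, P x y * V y + 1 ≤ V x + B.indicator (fun _ => b) x) :
    IsPositiveRecurrent P := by
  refine ⟨fun x hx => ?_, fun x => ?_⟩
  · exact meanHittingTime_lt_top_of_drift (A := {x}) (D := {y | Reachable P x y}) hB hb hV hdrift
      (fun y hy z hz => Relation.ReflTransGen.tail hy hz) (fun y hy => ⟨x, rfl, hx y hy⟩) .refl
  · have hhit : ∀ x, ∃ y ∈ B, Reachable P x y := by
      intro x
      -- For hitting `B` itself, `V + b 1_B` is a supersolution: only its values off `B` enter the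
      -- left side, where it equals `V`.
      refine reachable_of_meanHittingTime_lt_top ((meanHittingTime_le (D := univ)
        (f := fun y => V y + B.indicator (fun _ => b) y) (by simp) (fun y _ => ?_)
        (mem_univ x)).trans_lt (ENNReal.add_lt_top.2 ⟨(hV x).lt_top, ?_⟩))
      · refine le_trans ?_ (hdrift y)
        rw [add_comm]
        refine add_le_add (ENNReal.tsum_le_tsum fun z => ?_) le_rfl
        by_cases hz : z ∈ B <;> simp [hz]
      · exact (indicator_le_self' (fun _ _ => zero_le) x).trans_lt hb.lt_top
    refine meanHittingTime_lt_top_of_drift (D := univ) hB hb hV hdrift (by simp)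
      (fun y _ => ?_) (mem_univ x)
    obtain ⟨z, hz, hyz⟩ := exists_isEssential_reachable hB hhit y
    exact ⟨z, hz, hyz⟩

/-! ### A stationary law from the occupation measure of an excursion. -/

/-- The probability that the chain started at `x` is at `y` at time `k` and has not come back to
`x` before. -/
noncomputable def tabooProb (P : S → PMF S) (x : S) : ℕ → S → ℝ≥0∞
  | 0 => ({x} : Set S).indicator 1
  | k + 1 => ({x}ᶜ : Set S).indicator fun y => ∑' z, tabooProb P x k z * P z y

/-- The Markov property at time `k` for a path avoiding `x`. With `m = 0`, the mass of `tabooProb P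
x k` is `ℙ_x(T_x > k)`. -/
theorem tsum_tabooProb_mul_avoidProb (P : S → PMF S) (x : S) (k m : ℕ) :
    ∑' y, tabooProb P x k y * avoidProb P {x} m y = avoidProb P {x} (k + m) x := by
  induction k generalizing m with
  | zero =>
    rw [tsum_eq_single x]
    · simp [tabooProb]
    · intro y hy; simp [tabooProb, hy]
  | succ k ih =>
    rw [add_right_comm, add_assoc, ← ih (m + 1)]
    simp only [tabooProb, avoidProb, ← ENNReal.tsum_mul_left]
    rw [ENNReal.tsum_comm]
    refine tsum_congr fun y => ?_
    by_cases hy : y ∈ ({x}ᶜ : Set S)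
    · simp only [indicator_of_mem hy, ← ENNReal.tsum_mul_right, mul_assoc]
    · simp [indicator_of_notMem hy]

/-- `ν y` is the mean number of visits to `y` before the return to `x`, so its mass is the mean
return time. Away from `x` invariance is a shift of the time index; at `x` it follows from
conservation of the finite total mass. -/
theorem exists_isStationary {P : S → PMF S} {x : S} (hx : meanHittingTime P {x} x < ∞) :
    ∃ π, IsStationary P π := by
  set ν : S → ℝ≥0∞ := fun y => ∑' k, tabooProb P x k y with hν
  have hmass : ∑' y, ν y = meanHittingTime P {x} x := by
    rw [hν, ENNReal.tsum_comm]
    refine tsum_congr fun k => ?_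
    simpa [avoidProb] using tsum_tabooProb_mul_avoidProb P x k 0
  have hone : 1 ≤ meanHittingTime P {x} x := ENNReal.le_tsum (f := fun k => avoidProb P {x} k x) 0
  have h0 : meanHittingTime P {x} x ≠ 0 := (zero_lt_one.trans_le hone).ne'
  have hinv : ∀ y, ∑' z, ν z * P z y = ν y := by
    have hne : ∀ y, y ≠ x → ∑' z, ν z * P z y = ν y := by
      intro y hy
      simp only [hν, ← ENNReal.tsum_mul_right]
      rw [ENNReal.tsum_comm, tsum_eq_zero_add' (f := fun k => tabooProb P x k y) ENNReal.summable]
      simp [tabooProb, hy]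
    have htot : ∑' y, ∑' z, ν z * P z y = ∑' y, ν y := by
      rw [ENNReal.tsum_comm]
      simp [ENNReal.tsum_mul_left, PMF.tsum_coe]
    intro y
    classical
    by_cases hy : y = x
    · subst hy
      rw [ENNReal.tsum_eq_add_tsum_ite y,
        ENNReal.tsum_eq_add_tsum_ite (f := ν) y] at htot
      have hrest : (∑' w, if w = y then 0 else ∑' z, ν z * P z w) =
          ∑' w, if w = y then 0 else ν w := by
        refine tsum_congr fun w => ?_
        split_ifs with hw
        · rfl
        · exact hne w hw
      rw [hrest] at htot
      refine (ENNReal.add_left_inj ?_).1 htot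
      refine ne_top_of_le_ne_top (hmass ▸ hx.ne) (ENNReal.tsum_le_tsum fun w => ?_)
      split_ifs <;> simp
    · exact hne y hy
  refine ⟨PMF.normalize ν (hmass ▸ h0) (hmass ▸ hx.ne), ?_⟩
  ext y
  simp only [PMF.bind_apply, PMF.normalize_apply]
  simp_rw [mul_right_comm, ENNReal.tsum_mul_right, hinv]

theorem exists_isStationary_of_isPositiveRecurrent [Nonempty S] {P : S → PMF S}
    (h : IsPositiveRecurrent P) : ∃ π, IsStationary P π := by
  obtain ⟨x⟩ := ‹Nonempty S›
  obtain ⟨a, ha, -⟩ := reachable_of_meanHittingTime_lt_top (h.2 x)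
  exact exists_isStationary (h.1 a ha)

end MarkovChain

/-! ### Discrete laws as measures. -/

namespace PMF

variable {α β : Type*} [MeasurableSpace α] [MeasurableSpace β]

theorem integrable_of_finite_support [DiscreteMeasurableSpace α] {E : Type*}
    [NormedAddCommGroup E] {p : PMF α} (hp : p.support.Finite) (f : α → E) :
    Integrable f p.toMeasure := by
  rw [← p.restrict_toMeasure_support]
  exact IntegrableOn.finset (s := hp.toFinset) (f := f) (μ := p.toMeasure) |>.mono_set (by simp)

theorem ae_of_forall_support [DiscreteMeasurableSpace α] {p : PMF α} {Q : α → Prop}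
    (h : ∀ x ∈ p.support, Q x) : ∀ᵐ x ∂p.toMeasure, Q x := by
  rw [← p.restrict_toMeasure_support]
  exact (ae_restrict_iff' (MeasurableSet.of_discrete)).2 (.of_forall h)

theorem toMeasure_bind_map_prodMk [Countable α] [Countable β] [DiscreteMeasurableSpace α]
    [DiscreteMeasurableSpace β] (p : PMF α) (q : PMF β) :
    (p.bind fun x => q.map (Prod.mk x)).toMeasure = p.toMeasure.prod q.toMeasure := by
  refine Measure.ext_of_singleton fun ⟨x, y⟩ => ?_
  rw [PMF.toMeasure_apply_singleton _ _ (MeasurableSet.singleton _), ← singleton_prod_singleton,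
    Measure.prod_prod, PMF.toMeasure_apply_singleton _ _ (MeasurableSet.singleton _),
    PMF.toMeasure_apply_singleton _ _ (MeasurableSet.singleton _), PMF.bind_apply,
    tsum_eq_single x]
  · rw [PMF.map_apply, tsum_eq_single y]
    · simp
    · intro z hz; simp [hz.symm]
  · intro z hz
    simp [PMF.map_apply, hz.symm]

theorem lintegral_bind [Countable α] [Countable β] [DiscreteMeasurableSpace α]
    [DiscreteMeasurableSpace β] (p : PMF α) (q : α → PMF β) (f : β → ℝ≥0∞) :
    ∫⁻ y, f y ∂(p.bind q).toMeasure = ∫⁻ x, ∫⁻ y, f y ∂(q x).toMeasure ∂p.toMeasure := by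
  simp only [lintegral_countable', PMF.toMeasure_apply_singleton _ _ (MeasurableSet.singleton _),
    PMF.bind_apply, ← ENNReal.tsum_mul_left, ← ENNReal.tsum_mul_right]
  rw [ENNReal.tsum_comm]
  exact tsum_congr fun x => tsum_congr fun y => by ring

end PMF

/-! ### Drift conditions in steady state. -/

namespace MarkovChain

variable {S : Type*} [MeasurableSpace S] [Countable S] [DiscreteMeasurableSpace S]

theorem tsum_mul_eq_lintegral (p : PMF S) (f : S → ℝ≥0∞) :
    ∑' y, p y * f y = ∫⁻ y, f y ∂p.toMeasure := by
  simp only [lintegral_countable', PMF.toMeasure_apply_singleton _ _ (MeasurableSet.singleton _),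
    mul_comm]

/-- If the drift of `f ≥ 0` is at most `b - g`, then the mean of `g` in steady state is at
most `b`; no integrability of `f` is needed. -/
theorem IsStationary.lintegral_le {P : S → PMF S} {π : PMF S} (hπ : IsStationary P π)
    {f g : S → ℝ≥0∞} {b : ℝ≥0∞} (hf : ∀ x, f x ≠ ∞)
    (hdrift : ∀ x, ∫⁻ y, f y ∂(P x).toMeasure + g x ≤ f x + b) :
    ∫⁻ x, g x ∂π.toMeasure ≤ b := by
  -- The truncation `min f m` has a finite stationary mean, which can be cancelled. Where `f > m`
  -- its mean cannot increase, so only the region `f ≤ m` needs the drift bound; monotone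
  -- convergence then removes `m`.
  have hm : ∀ m : ℕ, ∫⁻ x, {x | f x ≤ m}.indicator g x ∂π.toMeasure ≤ b := by
    intro m
    have hpt : ∀ x, ∫⁻ y, min (f y) m ∂(P x).toMeasure + {x | f x ≤ m}.indicator g x ≤
        min (f x) m + b := by
      intro x
      by_cases hx : f x ≤ m
      · rw [indicator_of_mem (show x ∈ {x | f x ≤ m} from hx), min_eq_left hx]
        exact (add_le_add (lintegral_mono fun y => min_le_left _ _) le_rfl).trans (hdrift x)
      · rw [indicator_of_notMem (show x ∉ {x | f x ≤ m} from hx), min_eq_right (le_of_not_ge hx), add_zero]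
        calc ∫⁻ y, min (f y) m ∂(P x).toMeasure ≤ ∫⁻ y, m ∂(P x).toMeasure :=
              lintegral_mono fun y => min_le_right _ _
          _ = m := by simp
          _ ≤ m + b := le_self_add
    have hint := lintegral_mono (μ := π.toMeasure) hpt
    rw [lintegral_add_left .of_discrete, lintegral_add_left .of_discrete, lintegral_const,
      measure_univ, mul_one, ← PMF.lintegral_bind, show π.bind P = π from hπ] at hint
    refine (ENNReal.add_le_add_iff_left ?_).1 hint
    refine ((lintegral_mono fun x => min_le_right _ _).trans_lt (b := ∫⁻ x, (m : ℝ≥0∞) ∂π.toMeasure)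
      ?_).ne
    simp
  have hsup : ∀ x, g x = ⨆ m : ℕ, {x | f x ≤ m}.indicator g x := by
    intro x
    obtain ⟨m, hmx⟩ := ENNReal.exists_nat_gt (hf x)
    refine le_antisymm (le_iSup_of_le m ?_) (iSup_le fun m => indicator_le_self' (by simp) x)
    rw [indicator_of_mem (show x ∈ {x | f x ≤ m} from hmx.le)]
  rw [lintegral_congr hsup, lintegral_iSup (fun _ => .of_discrete)]
  · exact iSup_le hm
  · intro m m' hmm x
    refine indicator_le_indicator_of_subset (fun x (hx : f x ≤ m) => ?_) (by simp) x
    exact hx.trans (by exact_mod_cast hmm)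

/-- `IsStationary.lintegral_le` for real functions and transition laws of finite support. -/
theorem IsStationary.integral_le {P : S → PMF S} {π : PMF S} (hπ : IsStationary P π)
    (hP : ∀ x, (P x).support.Finite) {f g : S → ℝ} {b : ℝ} (hf : ∀ x, 0 ≤ f x)
    (hg : ∀ x, 0 ≤ g x) (hb : 0 ≤ b)
    (hdrift : ∀ x, ∫ y, f y ∂(P x).toMeasure + g x ≤ f x + b) :
    Integrable g π.toMeasure ∧ ∫ x, g x ∂π.toMeasure ≤ b := by
  have h := hπ.lintegral_le (f := fun x => .ofReal (f x)) (g := fun x => .ofReal (g x))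
    (b := .ofReal b) (by simp) fun x => by
      rw [← ofReal_integral_eq_lintegral_ofReal (PMF.integrable_of_finite_support (hP x) f)
        (.of_forall hf), ← ENNReal.ofReal_add (integral_nonneg hf) (hg x),
        ← ENNReal.ofReal_add (hf x) hb]
      exact ENNReal.ofReal_le_ofReal (hdrift x)
  have hgm : AEStronglyMeasurable g π.toMeasure := Measurable.of_discrete.aestronglyMeasurable
  refine ⟨⟨hgm, ?_⟩, ?_⟩
  · rw [hasFiniteIntegral_iff_ofReal (.of_forall hg)]
    exact h.trans_lt ENNReal.ofReal_lt_top
  · rw [integral_eq_lintegral_of_nonneg_ae (.of_forall hg) hgm]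
    exact ENNReal.toReal_le_of_le_ofReal hb h

theorem isPositiveRecurrent_of_integral_drift {P : S → PMF S} (hP : ∀ x, (P x).support.Finite)
    {V : S → ℝ} {b : ℝ} {B : Set S} (hB : B.Finite) (hb : 0 ≤ b) (hV : ∀ x, 0 ≤ V x)
    (hdrift : ∀ x, ∫ y, V y ∂(P x).toMeasure + 1 ≤ V x + B.indicator (fun _ => b) x) :
    IsPositiveRecurrent P := by
  refine isPositiveRecurrent_of_drift (V := fun x => .ofReal (V x)) (b := .ofReal b) hB (by simp)
    (by simp) fun x => ?_
  rw [tsum_mul_eq_lintegral, ← ofReal_integral_eq_lintegral_ofReal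
    (PMF.integrable_of_finite_support (hP x) V) (.of_forall hV), ← ENNReal.ofReal_one,
    ← ENNReal.ofReal_add (integral_nonneg hV) zero_le_one]
  refine (ENNReal.ofReal_le_ofReal (hdrift x)).trans ?_
  rw [ENNReal.ofReal_add (hV x) (indicator_nonneg (fun _ _ => hb) x)]
  by_cases hx : x ∈ B <;> simp [hx]

end MarkovChain

/-! ### A time slot as a deterministic map of independent inputs. -/

namespace LoadBalancing

variable {n : ℕ}

/-- The joint law of the arrivals and of the potential services of a time slot. -/
noncomputable def noise (service : PMF (Fin n → ℕ)) (arrival : PMF ℕ) :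
    PMF (ℕ × (Fin n → ℕ)) :=
  arrival.bind fun a => service.map (Prod.mk a)

/-- The joint law of the selected queue, the arrivals and the potential services of a time slot,
given the queue lengths. -/
noncomputable def slot (service : PMF (Fin n → ℕ)) (arrival : PMF ℕ) (route : Routing n)
    (q : Fin n → ℕ) : PMF (Fin n × ℕ × (Fin n → ℕ)) :=
  (route q).bind fun i => (noise service arrival).map (Prod.mk i)

/-- The queue lengths after a time slot. -/
def next (q : Fin n → ℕ) (ω : Fin n × ℕ × (Fin n → ℕ)) : Fin n → ℕ :=
  fun j => q j + (if j = ω.1 then ω.2.1 else 0) - ω.2.2 j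

/-- The total queue length. -/
noncomputable def total (q : Fin n → ℕ) : ℝ := ∑ i, (q i : ℝ)

variable {service : PMF (Fin n → ℕ)} {arrival : PMF ℕ} {route : Routing n} {Amax Smax : ℕ}

theorem step_eq_map (q : Fin n → ℕ) :
    step service arrival route q = (slot service arrival route q).map (next q) := by
  simp only [step, slot, noise, PMF.map, PMF.bind_bind, PMF.pure_bind, Function.comp_def]
  rfl

theorem noise_toMeasure :
    (noise service arrival).toMeasure = arrival.toMeasure.prod service.toMeasure :=
  PMF.toMeasure_bind_map_prodMk _ _

theorem slot_toMeasure (q : Fin n → ℕ) : (slot service arrival route q).toMeasure =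
    (route q).toMeasure.prod (noise service arrival).toMeasure :=
  PMF.toMeasure_bind_map_prodMk _ _

theorem mem_support_noise {ω : ℕ × (Fin n → ℕ)} (h : ω ∈ (noise service arrival).support) :
    ω.1 ∈ arrival.support ∧ ω.2 ∈ service.support := by
  simp only [noise, PMF.mem_support_bind_iff, PMF.mem_support_map_iff] at h
  obtain ⟨a, ha, s, hs, rfl⟩ := h
  exact ⟨ha, hs⟩

theorem mem_support_slot {q : Fin n → ℕ} {ω : Fin n × ℕ × (Fin n → ℕ)}
    (h : ω ∈ (slot service arrival route q).support) :
    ω.1 ∈ (route q).support ∧ ω.2.1 ∈ arrival.support ∧ ω.2.2 ∈ service.support := by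
  simp only [slot, PMF.mem_support_bind_iff, PMF.mem_support_map_iff] at h
  obtain ⟨i, hi, w, hw, rfl⟩ := h
  exact ⟨hi, mem_support_noise hw⟩

theorem finite_support_service (hs : ∀ s ∈ service.support, ∀ i, s i ≤ Smax) :
    service.support.Finite :=
  (Set.finite_Iic (fun _ : Fin n => Smax)).subset hs

theorem finite_support_arrival (ha : ∀ a ∈ arrival.support, a ≤ Amax) :
    arrival.support.Finite :=
  (Set.finite_Iic Amax).subset ha

theorem finite_support_noise (hs : ∀ s ∈ service.support, ∀ i, s i ≤ Smax)
    (ha : ∀ a ∈ arrival.support, a ≤ Amax) : (noise service arrival).support.Finite :=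
  ((finite_support_arrival ha).prod (finite_support_service hs)).subset
    fun _ h => mem_support_noise h

theorem finite_support_slot (hs : ∀ s ∈ service.support, ∀ i, s i ≤ Smax)
    (ha : ∀ a ∈ arrival.support, a ≤ Amax) (q : Fin n → ℕ) :
    (slot service arrival route q).support.Finite :=
  (Set.finite_univ.prod ((finite_support_arrival ha).prod (finite_support_service hs))).subset
    fun _ h => ⟨trivial, (mem_support_slot h).2⟩

theorem finite_support_step (hs : ∀ s ∈ service.support, ∀ i, s i ≤ Smax)
    (ha : ∀ a ∈ arrival.support, a ≤ Amax) (q : Fin n → ℕ) :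
    (step service arrival route q).support.Finite := by
  rw [step_eq_map, PMF.support_map]
  exact (finite_support_slot hs ha q).image _

theorem integral_step {E : Type*} [NormedAddCommGroup E] [NormedSpace ℝ E]
    (q : Fin n → ℕ) (f : (Fin n → ℕ) → E) :
    ∫ y, f y ∂(step service arrival route q).toMeasure =
      ∫ ω, f (next q ω) ∂(slot service arrival route q).toMeasure := by
  rw [step_eq_map, ← PMF.toMeasure_map (f := next q) _ Measurable.of_discrete,
    integral_map Measurable.of_discrete.aemeasurable
      (StronglyMeasurable.of_discrete).aestronglyMeasurable]

theorem integral_slot_noise {E : Type*} [NormedAddCommGroup E] [NormedSpace ℝ E]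
    (q : Fin n → ℕ) (f : ℕ × (Fin n → ℕ) → E) :
    ∫ ω, f ω.2 ∂(slot service arrival route q).toMeasure =
      ∫ w, f w ∂(noise service arrival).toMeasure := by
  rw [slot_toMeasure, integral_fun_snd]; simp

theorem integral_noise_arrival {E : Type*} [NormedAddCommGroup E] [NormedSpace ℝ E] (f : ℕ → E) :
    ∫ w, f w.1 ∂(noise service arrival).toMeasure = ∫ a, f a ∂arrival.toMeasure := by
  rw [noise_toMeasure, integral_fun_fst]; simp

theorem integral_noise_service {E : Type*} [NormedAddCommGroup E] [NormedSpace ℝ E]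
    (f : (Fin n → ℕ) → E) :
    ∫ w, f w.2 ∂(noise service arrival).toMeasure = ∫ s, f s ∂service.toMeasure := by
  rw [noise_toMeasure, integral_fun_snd]; simp

theorem integral_slot_arrival (q : Fin n → ℕ) :
    ∫ ω, (ω.2.1 : ℝ) ∂(slot service arrival route q).toMeasure = arrivalRate arrival := by
  rw [integral_slot_noise q fun w => (w.1 : ℝ), integral_noise_arrival fun a => (a : ℝ),
    arrivalRate]

theorem integral_slot_service (q : Fin n → ℕ) (j : Fin n) :
    ∫ ω, (ω.2.2 j : ℝ) ∂(slot service arrival route q).toMeasure = serviceRate service j := by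
  rw [integral_slot_noise q fun w => (w.2 j : ℝ), integral_noise_service fun s => (s j : ℝ),
    serviceRate]

/-! ### The projection on the diagonal -/

theorem starProjection_diagonal (hn : 0 < n) (y : EuclideanSpace ℝ (Fin n)) :
    (diagonal n).starProjection y = ((∑ i, y i) / n) • oneVec n := by
  refine Submodule.eq_starProjection_of_mem_of_inner_eq_zero ?_ fun w hw => ?_
  · intro i j; simp [oneVec]
  have hw' : ∀ i, w i = w ⟨0, hn⟩ := fun i => hw _ _
  have hn' : (n : ℝ) ≠ 0 := by positivity
  simp [PiLp.inner_apply, oneVec, hw', ← Finset.mul_sum, Finset.sum_sub_distrib]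
  right
  field_simp
  simp

theorem perp_apply (hn : 0 < n) (y : EuclideanSpace ℝ (Fin n)) (i : Fin n) :
    perp y i = y i - (∑ i, y i) / n := by
  simp [perp, starProjection_diagonal hn, oneVec]

theorem norm_sq_perp (hn : 0 < n) (y : EuclideanSpace ℝ (Fin n)) :
    ‖perp y‖ ^ 2 = ‖y‖ ^ 2 - (∑ i, y i) ^ 2 / n := by
  have hn' : (n : ℝ) ≠ 0 := by positivity
  simp only [EuclideanSpace.norm_sq_eq, perp_apply hn, Real.norm_eq_abs, sq_abs, sub_sq,
    Finset.sum_add_distrib, Finset.sum_sub_distrib, ← Finset.sum_mul, ← Finset.mul_sum]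
  simp
  field_simp
  ring

theorem perp_sub (x y : EuclideanSpace ℝ (Fin n)) : perp (x - y) = perp x - perp y := by
  simp only [perp, map_sub]; abel

theorem norm_perp_le (hn : 0 < n) (y : EuclideanSpace ℝ (Fin n)) : ‖perp y‖ ≤ ‖y‖ := by
  refine le_of_sq_le_sq ?_ (norm_nonneg _)
  rw [norm_sq_perp hn]
  have : 0 ≤ (∑ i, y i) ^ 2 / (n : ℝ) := by positivity
  linarith

theorem norm_sq_toVec (q : Fin n → ℕ) : ‖toVec q‖ ^ 2 = ∑ j, (q j : ℝ) ^ 2 := by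
  simp [EuclideanSpace.norm_sq_eq, toVec]

theorem norm_sq_perp_toVec (hn : 0 < n) (q : Fin n → ℕ) :
    ‖perp (toVec q)‖ ^ 2 = ‖toVec q‖ ^ 2 - total q ^ 2 / n := by
  rw [norm_sq_perp hn]; simp [toVec, total]

theorem total_nonneg (q : Fin n → ℕ) : 0 ≤ total q := by unfold total; positivity

theorem norm_toVec_le_total (q : Fin n → ℕ) : ‖toVec q‖ ≤ total q := by
  refine le_of_sq_le_sq ?_ (total_nonneg q)
  rw [norm_sq_toVec, total]
  exact Finset.sum_sq_le_sq_sum_of_nonneg fun i _ => Nat.cast_nonneg _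

theorem total_le_norm_toVec (q : Fin n → ℕ) : total q ≤ n * ‖toVec q‖ := by
  calc total q ≤ ∑ _i : Fin n, ‖toVec q‖ := Finset.sum_le_sum fun i _ => by
        simpa [toVec] using PiLp.norm_apply_le (toVec q) i
    _ = _ := by simp

/-- `‖q_⊥‖` is at most the distance from `q` to the diagonal point `m 1`, and the `ℓ²` norm is at
most the `ℓ¹` norm. With `m` the shortest length, a drift in terms of the gaps becomes a drift in
terms of `‖q_⊥‖`. -/
theorem norm_perp_toVec_le_sum_sub (hn : 0 < n) (q : Fin n → ℕ) (m : ℝ) (hm : ∀ j, m ≤ q j) :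
    ‖perp (toVec q)‖ ≤ ∑ j, ((q j : ℝ) - m) := by
  have hn' : (0 : ℝ) < n := by positivity
  refine le_of_sq_le_sq ?_ (Finset.sum_nonneg fun j _ => by linarith [hm j])
  refine le_trans ?_ (Finset.sum_sq_le_sq_sum_of_nonneg fun j _ => by linarith [hm j])
  rw [norm_sq_perp_toVec hn, norm_sq_toVec]
  simp only [sub_sq, Finset.sum_add_distrib, Finset.sum_sub_distrib, ← Finset.sum_mul,
    ← Finset.mul_sum]
  rw [← total]
  simp
  have : 0 ≤ (total q - n * m) ^ 2 / n := by positivity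
  have h2 : (total q - n * m) ^ 2 / n = total q ^ 2 / n - 2 * total q * m + n * m ^ 2 := by
    field_simp; ring
  linarith

/-! ### Quadratic drifts under JSQ. -/

theorem cast_next (q : Fin n → ℕ) (ω : Fin n × ℕ × (Fin n → ℕ)) (j : Fin n) :
    (next q ω j : ℝ) = max ((q j : ℝ) + (if j = ω.1 then (ω.2.1 : ℝ) else 0) - ω.2.2 j) 0 := by
  have h : ∀ x y : ℕ, ((x - y : ℕ) : ℝ) = max ((x : ℝ) - y) 0 := by
    intro x y
    rcases le_total y x with h | h
    · rw [Nat.cast_sub h, max_eq_left (by simpa using h)]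
    · rw [Nat.sub_eq_zero_of_le h, max_eq_right (by simpa using h)]; simp
  rw [next, h]; push_cast; rfl

theorem sum_ite_mul (f : Fin n → ℝ) (i : Fin n) (a : ℝ) :
    ∑ j, f j * (if j = i then a else 0) = f i * a := by simp

/-- The bound `n (Amax + Smax)²` for the square of the length of a jump. -/
def jumpSq (n Amax Smax : ℕ) : ℝ := n * ((Amax : ℝ) + Smax) ^ 2

theorem jumpSq_nonneg (n Amax Smax : ℕ) : 0 ≤ jumpSq n Amax Smax := by unfold jumpSq; positivity

theorem sq_ite_sub_le {a s A S : ℝ} (ha : 0 ≤ a) (hs : 0 ≤ s) (haA : a ≤ A) (hsS : s ≤ S)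
    (p : Prop) [Decidable p] : ((if p then a else 0) - s) ^ 2 ≤ (A + S) ^ 2 := by
  refine sq_le_sq' ?_ ?_ <;> split_ifs <;> linarith

/-- Truncation at `0` only decreases the square, so it may be ignored in an upper bound. -/
theorem norm_sq_next_le {ω : Fin n × ℕ × (Fin n → ℕ)} (ha : ω.2.1 ≤ Amax)
    (hs : ∀ j, ω.2.2 j ≤ Smax) (q : Fin n → ℕ) :
    ‖toVec (next q ω)‖ ^ 2 ≤ ‖toVec q‖ ^ 2 + 2 * (q ω.1 * ω.2.1) -
      2 * ∑ j, (q j : ℝ) * ω.2.2 j + jumpSq n Amax Smax := by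
  rw [norm_sq_toVec, norm_sq_toVec]
  have h : ∀ j, (next q ω j : ℝ) ^ 2 ≤ (q j : ℝ) ^ 2 +
      2 * ((q j : ℝ) * (if j = ω.1 then (ω.2.1 : ℝ) else 0)) - 2 * ((q j : ℝ) * ω.2.2 j) +
      ((Amax : ℝ) + Smax) ^ 2 := by
    intro j
    have h1 := sq_ite_sub_le (a := ω.2.1) (s := ω.2.2 j) (A := Amax) (S := Smax) (by positivity)
      (by positivity) (by exact_mod_cast ha) (by exact_mod_cast hs j) (j = ω.1)
    rw [cast_next]
    have h2 : ∀ x : ℝ, max x 0 ^ 2 ≤ x ^ 2 := fun x => by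
      rcases le_total x 0 with h | h
      · rw [max_eq_right h]; simpa using sq_nonneg x
      · rw [max_eq_left h]
    refine (h2 _).trans ?_
    linarith
  refine (Finset.sum_le_sum fun j _ => h j).trans_eq ?_
  simp only [Finset.sum_add_distrib, Finset.sum_sub_distrib, ← Finset.mul_sum, sum_ite_mul, jumpSq]
  simp

theorem le_total_next (q : Fin n → ℕ) (ω : Fin n × ℕ × (Fin n → ℕ)) :
    total q + ω.2.1 - ∑ j, (ω.2.2 j : ℝ) ≤ total (next q ω) := by
  have := sum_ite_mul (fun _ => 1) ω.1 (ω.2.1 : ℝ)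
  simp only [one_mul] at this
  rw [total, total, ← this, ← Finset.sum_add_distrib, ← Finset.sum_sub_distrib]
  exact Finset.sum_le_sum fun j _ => by rw [cast_next]; exact le_max_left _ _

theorem norm_toVec_next_sub_le {ω : Fin n × ℕ × (Fin n → ℕ)} (ha : ω.2.1 ≤ Amax)
    (hs : ∀ j, ω.2.2 j ≤ Smax) (q : Fin n → ℕ) :
    ‖toVec (next q ω) - toVec q‖ ≤ √(jumpSq n Amax Smax) := by
  refine Real.le_sqrt_of_sq_le ?_
  rw [EuclideanSpace.norm_sq_eq, jumpSq]
  have h : ∀ j, ‖(toVec (next q ω) - toVec q) j‖ ^ 2 ≤ ((Amax : ℝ) + Smax) ^ 2 := by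
    intro j
    have h1 := sq_ite_sub_le (a := ω.2.1) (s := ω.2.2 j) (A := Amax) (S := Smax) (by positivity)
      (by positivity) (by exact_mod_cast ha) (by exact_mod_cast hs j) (j = ω.1)
    refine le_trans ?_ h1
    rw [Real.norm_eq_abs, sq_abs, sq_le_sq]
    simp only [toVec, PiLp.sub_apply, cast_next]
    have hq : (0 : ℝ) ≤ q j := Nat.cast_nonneg _
    rcases le_total ((q j : ℝ) + (if j = ω.1 then (ω.2.1 : ℝ) else 0) - ω.2.2 j) 0 with h | h
    · rw [max_eq_right h, zero_sub, abs_neg, abs_of_nonneg hq]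
      refine le_abs.2 (.inr ?_); linarith
    · rw [max_eq_left h]; apply le_of_eq; congr 1; ring
  refine (Finset.sum_le_sum fun j _ => h j).trans_eq (by simp)

/-- The mean drift of `‖q‖²` under JSQ; the queue `j₀` is a shortest one. -/
theorem integral_norm_sq_next_le (hs : ∀ s ∈ service.support, ∀ i, s i ≤ Smax)
    (ha : ∀ a ∈ arrival.support, a ≤ Amax) (hr : IsJSQ route) (q : Fin n → ℕ) {j₀ : Fin n}
    (hj₀ : ∀ j, q j₀ ≤ q j) :
    ∫ ω, ‖toVec (next q ω)‖ ^ 2 ∂(slot service arrival route q).toMeasure ≤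
      ‖toVec q‖ ^ 2 + jumpSq n Amax Smax -
        2 * ((totalRate service - arrivalRate arrival) * q j₀) -
        2 * ∑ j, serviceRate service j * ((q j : ℝ) - q j₀) := by
  have hfin := finite_support_slot (route := route) hs ha q
  have hint : ∀ f : Fin n × ℕ × (Fin n → ℕ) → ℝ,
    Integrable f (slot service arrival route q).toMeasure := PMF.integrable_of_finite_support hfin
  calc ∫ ω, ‖toVec (next q ω)‖ ^ 2 ∂(slot service arrival route q).toMeasure
      ≤ ∫ ω, (‖toVec q‖ ^ 2 + 2 * (q j₀ * ω.2.1) - 2 * ∑ j, (q j : ℝ) * ω.2.2 j +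
          jumpSq n Amax Smax) ∂(slot service arrival route q).toMeasure := by
        refine integral_mono_ae (hint _) (hint _) (PMF.ae_of_forall_support fun ω hω => ?_)
        obtain ⟨h1, h2, h3⟩ := mem_support_slot hω
        -- JSQ enters here: the length of the selected queue is the minimum whatever the
        -- tie-breaking, hence a constant that comes out of the integral.
        have hq : q ω.1 = q j₀ := le_antisymm (hr q _ h1 _) (hj₀ _)
        have := norm_sq_next_le (ha _ h2) (hs _ h3) q
        rwa [hq] at this
    _ = ‖toVec q‖ ^ 2 + 2 * (q j₀ * arrivalRate arrival) -
          2 * ∑ j, (q j : ℝ) * serviceRate service j + jumpSq n Amax Smax := by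
        rw [integral_add (hint _) (hint _), integral_sub (hint _) (hint _),
          integral_add (hint _) (hint _), integral_const_mul, integral_const_mul,
          integral_const_mul, integral_finsetSum _ fun _ _ => hint _]
        simp only [integral_const_mul, integral_slot_arrival, integral_slot_service]
        simp
    _ = _ := by
        simp only [mul_sub, Finset.sum_sub_distrib, ← Finset.sum_mul]
        rw [← totalRate, Finset.sum_congr rfl fun j _ => mul_comm (q j : ℝ) _]
        ring

/-- The square lies above its tangent at `total q`, whose slope is nonnegative, so unused service
can be dropped. A lower bound is what is needed, as `total²` enters `‖q_⊥‖²` with a minus sign. -/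
theorem le_integral_total_next_sq (hs : ∀ s ∈ service.support, ∀ i, s i ≤ Smax)
    (ha : ∀ a ∈ arrival.support, a ≤ Amax) (q : Fin n → ℕ) :
    total q ^ 2 - 2 * total q * (totalRate service - arrivalRate arrival) ≤
      ∫ ω, total (next q ω) ^ 2 ∂(slot service arrival route q).toMeasure := by
  have hfin := finite_support_slot (route := route) hs ha q
  have hint : ∀ f : Fin n × ℕ × (Fin n → ℕ) → ℝ,
    Integrable f (slot service arrival route q).toMeasure := PMF.integrable_of_finite_support hfin
  calc total q ^ 2 - 2 * total q * (totalRate service - arrivalRate arrival)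
      = ∫ ω, (total q ^ 2 + 2 * total q * (ω.2.1 - ∑ j, (ω.2.2 j : ℝ)))
          ∂(slot service arrival route q).toMeasure := by
        rw [integral_add (hint _) (hint _), integral_const_mul, integral_sub (hint _) (hint _),
          integral_finsetSum _ fun _ _ => hint _]
        simp only [integral_slot_arrival, integral_slot_service, totalRate]
        simp
        ring
    _ ≤ _ := by
        refine integral_mono (hint _) (hint _) fun ω => ?_
        have h1 := le_total_next q ω
        have h2 := mul_le_mul_of_nonneg_left h1 (total_nonneg q)
        simp only
        nlinarith [sq_nonneg (total (next q ω) - total q)]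

/-- Under JSQ the mean drift of `‖q‖²` is negative if the queues are long. -/
theorem integral_norm_sq_next_le_sub_total (hn : 0 < n)
    (hs : ∀ s ∈ service.support, ∀ i, s i ≤ Smax)
    (ha : ∀ a ∈ arrival.support, a ≤ Amax) (hr : IsJSQ route) {δ : ℝ}
    (hδ : ∀ j, δ ≤ serviceRate service j)
    (hδ' : n * δ ≤ totalRate service - arrivalRate arrival) (q : Fin n → ℕ) :
    ∫ ω, ‖toVec (next q ω)‖ ^ 2 ∂(slot service arrival route q).toMeasure ≤
      ‖toVec q‖ ^ 2 + jumpSq n Amax Smax - 2 * (δ * total q) := by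
  have : Nonempty (Fin n) := ⟨⟨0, hn⟩⟩
  obtain ⟨j₀, hj₀⟩ := Finite.exists_min q
  refine (integral_norm_sq_next_le hs ha hr q hj₀).trans ?_
  -- The total splits into `n * q j₀`, paid for by the slack `n * δ`, and the gaps, paid for by the
  -- service rates.
  have h1 : δ * (total q - n * q j₀) ≤ ∑ j, serviceRate service j * ((q j : ℝ) - q j₀) := by
    have : total q - n * q j₀ = ∑ j, ((q j : ℝ) - q j₀) := by simp [total]
    rw [this, Finset.mul_sum]
    exact Finset.sum_le_sum fun j _ => mul_le_mul_of_nonneg_right (hδ j)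
      (by simpa using hj₀ j)
  have h2 := mul_le_mul_of_nonneg_right hδ' (Nat.cast_nonneg (α := ℝ) (q j₀))
  linarith

/-- Near heavy traffic the mean drift of `‖q_⊥‖²` under JSQ is negative if `‖q_⊥‖` is large. -/
theorem integral_norm_sq_perp_next_le (hn : 0 < n)
    (hs : ∀ s ∈ service.support, ∀ i, s i ≤ Smax)
    (ha : ∀ a ∈ arrival.support, a ≤ Amax) (hr : IsJSQ route) {δ : ℝ} (hδ0 : 0 ≤ δ)
    (hδ : ∀ j, 2 * δ ≤ serviceRate service j)
    (hδ' : totalRate service - arrivalRate arrival ≤ n * δ) (q : Fin n → ℕ) :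
    ∫ ω, ‖perp (toVec (next q ω))‖ ^ 2 ∂(slot service arrival route q).toMeasure ≤
      ‖perp (toVec q)‖ ^ 2 + jumpSq n Amax Smax - 2 * (δ * ‖perp (toVec q)‖) := by
  have : Nonempty (Fin n) := ⟨⟨0, hn⟩⟩
  have hn' : (0 : ℝ) < n := by positivity
  obtain ⟨j₀, hj₀⟩ := Finite.exists_min q
  have hint : ∀ f : Fin n × ℕ × (Fin n → ℕ) → ℝ,
    Integrable f (slot service arrival route q).toMeasure :=
      PMF.integrable_of_finite_support (finite_support_slot hs ha q)
  have hV := integral_norm_sq_next_le hs ha hr q hj₀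
  have hW := le_integral_total_next_sq (route := route) hs ha q
  have hp := norm_perp_toVec_le_sum_sub hn q (q j₀) fun j => by exact_mod_cast hj₀ j
  have hD : ∑ j, ((q j : ℝ) - q j₀) = total q - n * q j₀ := by simp [total]
  simp only [norm_sq_perp_toVec hn]
  rw [integral_sub (hint _) (hint _), integral_div]
  have h1 : 2 * δ * ∑ j, ((q j : ℝ) - q j₀) ≤
      ∑ j, serviceRate service j * ((q j : ℝ) - q j₀) := by
    rw [Finset.mul_sum]
    exact Finset.sum_le_sum fun j _ => mul_le_mul_of_nonneg_right (hδ j)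
      (by simpa using hj₀ j)
  have h2 := div_le_div_of_nonneg_right hW hn'.le
  set e := totalRate service - arrivalRate arrival
  -- The gaps contribute `-4δ` times their sum to the drift of `‖q‖²`; subtracting `total² / n`
  -- gives back at most `2δ` times that sum, and the terms `e * q j₀` cancel.
  have h3 : e / n * ∑ j, ((q j : ℝ) - q j₀) ≤ δ * ∑ j, ((q j : ℝ) - q j₀) := by
    refine mul_le_mul_of_nonneg_right ?_ ((norm_nonneg _).trans hp)
    rw [div_le_iff₀ hn']; linarith
  have h4 : (total q ^ 2 - 2 * total q * e) / n = total q ^ 2 / n - 2 * (e * q j₀) -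
      2 * (e / n * ∑ j, ((q j : ℝ) - q j₀)) := by
    rw [hD]; field_simp; ring
  have h5 := mul_le_mul_of_nonneg_left hp hδ0
  linarith

/-! ### Positive recurrence and exponential moments. -/

theorem finite_total_le (R : ℝ) : {q : Fin n → ℕ | total q ≤ R}.Finite := by
  refine (Set.finite_Iic fun _ : Fin n => ⌈R⌉₊).subset fun q hq j => ?_
  have h1 : (q j : ℝ) ≤ total q :=
    Finset.single_le_sum (f := fun j => (q j : ℝ)) (fun i _ => Nat.cast_nonneg _) (Finset.mem_univ j)
  exact_mod_cast (h1.trans hq).trans (Nat.le_ceil R)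

theorem isPositiveRecurrent_step (hn : 0 < n)
    (hs : ∀ s ∈ service.support, ∀ i, s i ≤ Smax)
    (ha : ∀ a ∈ arrival.support, a ≤ Amax) (hr : IsJSQ route) {δ : ℝ} (hδ0 : 0 < δ)
    (hδ : ∀ j, δ ≤ serviceRate service j)
    (hδ' : n * δ ≤ totalRate service - arrivalRate arrival) :
    MarkovChain.IsPositiveRecurrent (step service arrival route) := by
  have hK := jumpSq_nonneg n Amax Smax
  refine MarkovChain.isPositiveRecurrent_of_integral_drift (V := fun q => ‖toVec q‖ ^ 2)
    (b := jumpSq n Amax Smax + 1) (finite_support_step hs ha)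
    (finite_total_le ((jumpSq n Amax Smax + 1) / (2 * δ))) (by linarith)
    (fun q => by positivity) fun q => ?_
  rw [integral_step q fun q => ‖toVec q‖ ^ 2]
  have h := integral_norm_sq_next_le_sub_total hn hs ha hr hδ hδ' q
  by_cases hq : q ∈ {q : Fin n → ℕ | total q ≤ (jumpSq n Amax Smax + 1) / (2 * δ)}
  · rw [indicator_of_mem hq]
    have := mul_nonneg hδ0.le (total_nonneg q)
    linarith
  · rw [indicator_of_notMem hq]
    have : (jumpSq n Amax Smax + 1) / (2 * δ) < total q := not_le.1 hq
    rw [div_lt_iff₀ (by positivity)] at this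
    linarith

/-- Far out, `‖q‖` has drift at most `-δ / 2` and jumps at most `√K`. As `e^x ≤ 1 + x + x²` for `|x|
≤ 1` (this uses `hη1`), the mean of `exp (η ‖q‖)` is multiplied by at most `1 - ηδ/2 + η²K`, which
`hη2` bounds by `1 - ηδ/4`. -/
theorem integrable_exp_norm_toVec (hn : 0 < n)
    (hs : ∀ s ∈ service.support, ∀ i, s i ≤ Smax)
    (ha : ∀ a ∈ arrival.support, a ≤ Amax) (hr : IsJSQ route) {δ : ℝ} (hδ0 : 0 < δ)
    (hδ : ∀ j, δ ≤ serviceRate service j)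
    (hδ' : n * δ ≤ totalRate service - arrivalRate arrival) {π : PMF (Fin n → ℕ)}
    (hπ : MarkovChain.IsStationary (step service arrival route) π) {η : ℝ} (hη : 0 < η)
    (hη1 : η * √(jumpSq n Amax Smax) ≤ 1) (hη2 : η * jumpSq n Amax Smax ≤ δ / 4) :
    Integrable (fun q => Real.exp (η * ‖toVec q‖)) π.toMeasure := by
  set K := jumpSq n Amax Smax with hKdef
  have hK : 0 ≤ K := jumpSq_nonneg n Amax Smax
  set C := √K with hCdef
  have hC : 0 ≤ C := Real.sqrt_nonneg K
  have hCK : C ^ 2 = K := Real.sq_sqrt hK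
  set R : ℝ := K / δ + 1 with hRdef
  have hR : 0 < R := by positivity
  set κ : ℝ := η * δ / 4 with hκdef
  have hκ : 0 < κ := by positivity
  set b : ℝ := Real.exp (η * (R + C)) + κ * Real.exp (η * R) with hb
  have hjump : ∀ q, ∀ᵐ ω ∂(slot service arrival route q).toMeasure,
      |‖toVec (next q ω)‖ - ‖toVec q‖| ≤ C := fun q => by
    refine PMF.ae_of_forall_support fun ω hω => ?_
    obtain ⟨-, h2, h3⟩ := mem_support_slot hω
    exact (abs_norm_sub_norm_le _ _).trans (norm_toVec_next_sub_le (ha _ h2) (hs _ h3) q)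
  have hint : ∀ q, ∀ f : Fin n × ℕ × (Fin n → ℕ) → ℝ,
    Integrable f (slot service arrival route q).toMeasure := fun q =>
      PMF.integrable_of_finite_support (finite_support_slot hs ha q)
  have hdrift : ∀ q, ∫ y, Real.exp (η * ‖toVec y‖) ∂(step service arrival route q).toMeasure +
      κ * Real.exp (η * ‖toVec q‖) ≤ Real.exp (η * ‖toVec q‖) + b := by
    intro q
    rw [integral_step q fun q => Real.exp (η * ‖toVec q‖)]
    set Φ := ‖toVec q‖ with hΦ
    rcases le_or_gt Φ R with hq | hq
    · have h1 : ∫ ω, Real.exp (η * ‖toVec (next q ω)‖) ∂(slot service arrival route q).toMeasure ≤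
          Real.exp (η * (R + C)) := by
        refine (integral_mono_ae (hint q _) (hint q fun _ => Real.exp (η * (R + C))) ?_).trans_eq
          (by simp)
        filter_upwards [hjump q] with ω hω
        refine Real.exp_le_exp.2 (mul_le_mul_of_nonneg_left ?_ hη.le)
        linarith [(abs_le.1 hω).2]
      have h2 : κ * Real.exp (η * Φ) ≤ κ * Real.exp (η * R) := by gcongr
      have := Real.exp_pos (η * Φ)
      linarith
    · have hΦ0 : 0 < Φ := hR.trans hq
      have h1 : ∫ ω, Real.exp (η * ‖toVec (next q ω)‖) ∂(slot service arrival route q).toMeasure ≤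
          ∫ ω, Real.exp (η * Φ) * (1 + η * ((‖toVec (next q ω)‖ ^ 2 - Φ ^ 2) / (2 * Φ)) +
            η ^ 2 * K) ∂(slot service arrival route q).toMeasure := by
        refine integral_mono_ae (hint q _) (hint q _) ?_
        filter_upwards [hjump q] with ω hω
        set Ψ := ‖toVec (next q ω)‖
        have hx : |η * (Ψ - Φ)| ≤ 1 := by
          rw [abs_mul, abs_of_pos hη]
          exact (mul_le_mul_of_nonneg_left hω hη.le).trans hη1
        have h2 := (abs_le.1 (Real.norm_exp_sub_one_sub_id_le hx)).2
        have h3 : ‖η * (Ψ - Φ)‖ ^ 2 ≤ η ^ 2 * K := by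
          rw [Real.norm_eq_abs, sq_abs, mul_pow, ← hCK]
          exact mul_le_mul_of_nonneg_left (sq_le_sq' (abs_le.1 hω).1 (abs_le.1 hω).2) (sq_nonneg _)
        -- Concavity of the square root turns the drift of the squared norm into a drift of the
        -- norm.
        have h4 : Ψ - Φ ≤ (Ψ ^ 2 - Φ ^ 2) / (2 * Φ) := by
          rw [le_div_iff₀ (by positivity)]
          nlinarith [sq_nonneg (Ψ - Φ)]
        have h5 := mul_le_mul_of_nonneg_left h4 hη.le
        rw [show η * Ψ = η * Φ + η * (Ψ - Φ) by ring, Real.exp_add]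
        exact mul_le_mul_of_nonneg_left (by linarith) (Real.exp_pos _).le
      rw [integral_const_mul, integral_add (hint q _) (hint q _), integral_add (hint q _) (hint q _),
        integral_const_mul, integral_div, integral_sub (hint q _) (hint q _)] at h1
      have hV := integral_norm_sq_next_le_sub_total hn hs ha hr hδ hδ' q
      simp only [integral_const, probReal_univ, one_smul] at h1
      have h6 : (∫ ω, ‖toVec (next q ω)‖ ^ 2 ∂(slot service arrival route q).toMeasure - Φ ^ 2) /
          (2 * Φ) ≤ - δ / 2 := by
        rw [div_le_iff₀ (by positivity)]
        have h7 : K ≤ δ * Φ := by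
          have : K / δ < Φ := by linarith
          rw [div_lt_iff₀ hδ0] at this; linarith
        have h8 := mul_le_mul_of_nonneg_left (norm_toVec_le_total q) hδ0.le
        linarith
      have h7 := mul_le_mul_of_nonneg_left h6 hη.le
      have h8 : η ^ 2 * K ≤ η * (δ / 4) := by
        rw [sq, mul_assoc]; exact mul_le_mul_of_nonneg_left hη2 hη.le
      have h9 : Real.exp (η * Φ) * (1 + η * ((∫ ω, ‖toVec (next q ω)‖ ^ 2
          ∂(slot service arrival route q).toMeasure - Φ ^ 2) / (2 * Φ)) + η ^ 2 * K) ≤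
          Real.exp (η * Φ) * (1 - κ) :=
        mul_le_mul_of_nonneg_left (by simp only [hκdef]; linarith) (Real.exp_pos _).le
      have : 0 ≤ b := by positivity
      linarith
  have h := (hπ.integral_le (finite_support_step hs ha) (fun q => (Real.exp_pos _).le)
    (fun q => by positivity) (by positivity) hdrift).1
  simpa [hκ.ne'] using h.const_mul κ⁻¹

/-! ### State space collapse. -/

theorem exists_cubic_bound (K δ : ℝ) (hK : 0 ≤ K) (hδ : 0 < δ) : ∃ b, 0 ≤ b ∧ ∀ r, 0 ≤ r →
    2 * r ^ 2 * (K - 2 * (δ * r)) + K * (2 * r + √K) ^ 2 + r ^ 2 ≤ b := by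
  -- The coefficient of `r ^ 2` once the square is expanded: `2K + 8K + 1`. The cubic term `-4 δ r ^
  -- 3` dominates it beyond `r = M / δ`.
  set M := 10 * K + 1
  have hM : 0 < M := by positivity
  refine ⟨2 * K ^ 2 + M ^ 3 / δ ^ 2, by positivity, fun r hr => ?_⟩
  have h1 : (2 * r + √K) ^ 2 ≤ 8 * r ^ 2 + 2 * K := by
    nlinarith [sq_nonneg (2 * r - √K), Real.sq_sqrt hK]
  have h2 := mul_le_mul_of_nonneg_left h1 hK
  have h3 : M * r ^ 2 - δ * r ^ 3 ≤ M ^ 3 / δ ^ 2 := by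
    rcases le_total M (δ * r) with h | h
    · have : 0 ≤ (δ * r - M) * r ^ 2 := mul_nonneg (by linarith) (sq_nonneg r)
      have : 0 ≤ M ^ 3 / δ ^ 2 := by positivity
      nlinarith
    · have h4 : (δ * r) ^ 2 ≤ M ^ 2 := by gcongr
      have h5 : r ^ 2 ≤ M ^ 2 / δ ^ 2 := by
        rw [le_div_iff₀ (by positivity)]; linarith [mul_pow δ r 2]
      have h6 := mul_le_mul_of_nonneg_left h5 hM.le
      have h7 : M * (M ^ 2 / δ ^ 2) = M ^ 3 / δ ^ 2 := by ring
      have : 0 ≤ δ * r ^ 3 := by positivity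
      linarith
  have : 0 ≤ δ * r ^ 3 := by positivity
  simp only [M] at h3 ⊢
  nlinarith

/-- State space collapse: `𝔼[‖q̄_⊥‖²]` has a bound that is uniform near heavy traffic. -/
theorem integral_norm_sq_perp_le (hn : 0 < n)
    (hs : ∀ s ∈ service.support, ∀ i, s i ≤ Smax)
    (ha : ∀ a ∈ arrival.support, a ≤ Amax) (hr : IsJSQ route) {δ : ℝ} (hδ0 : 0 ≤ δ)
    (hδ : ∀ j, 2 * δ ≤ serviceRate service j)
    (hδ' : totalRate service - arrivalRate arrival ≤ n * δ) {π : PMF (Fin n → ℕ)}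
    (hπ : MarkovChain.IsStationary (step service arrival route) π) {b : ℝ} (hb0 : 0 ≤ b)
    (hb : ∀ r, 0 ≤ r → 2 * r ^ 2 * (jumpSq n Amax Smax - 2 * (δ * r)) +
      jumpSq n Amax Smax * (2 * r + √(jumpSq n Amax Smax)) ^ 2 + r ^ 2 ≤ b) :
    Integrable (fun q => ‖perp (toVec q)‖ ^ 2) π.toMeasure ∧
      ∫ q, ‖perp (toVec q)‖ ^ 2 ∂π.toMeasure ≤ b := by
  set K := jumpSq n Amax Smax with hKdef
  have hK : 0 ≤ K := jumpSq_nonneg n Amax Smax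
  refine hπ.integral_le (finite_support_step hs ha) (f := fun q => (‖perp (toVec q)‖ ^ 2) ^ 2)
    (fun q => by positivity) (fun q => by positivity) hb0 fun q => ?_
  rw [integral_step q fun q => (‖perp (toVec q)‖ ^ 2) ^ 2]
  have hint : ∀ f : Fin n × ℕ × (Fin n → ℕ) → ℝ,
    Integrable f (slot service arrival route q).toMeasure :=
      PMF.integrable_of_finite_support (finite_support_slot hs ha q)
  set r := ‖perp (toVec q)‖ with hrdef
  have hr0 : 0 ≤ r := norm_nonneg _
  -- Expand `t⁴` around `r²` in the variable `t²`; the remainder is `(t - r)² (t + r)²`, bounded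
  -- through the jump size. The drift of the fourth power is of order `-r³`, more than enough to
  -- control the second moment.
  have h1 : ∫ ω, (‖perp (toVec (next q ω))‖ ^ 2) ^ 2 ∂(slot service arrival route q).toMeasure ≤
      ∫ ω, ((r ^ 2) ^ 2 + 2 * r ^ 2 * (‖perp (toVec (next q ω))‖ ^ 2 - r ^ 2) +
        K * (2 * r + √K) ^ 2) ∂(slot service arrival route q).toMeasure := by
    refine integral_mono_ae (hint _) (hint _) (PMF.ae_of_forall_support fun ω hω => ?_)
    obtain ⟨-, h2, h3⟩ := mem_support_slot hω
    simp only
    set t := ‖perp (toVec (next q ω))‖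
    have ht0 : 0 ≤ t := norm_nonneg _
    have h4 : |t - r| ≤ √K := by
      refine (abs_norm_sub_norm_le _ _).trans ?_
      rw [← perp_sub]
      exact (norm_perp_le hn _).trans (norm_toVec_next_sub_le (ha _ h2) (hs _ h3) q)
    have h5 : (t - r) ^ 2 ≤ K := by
      rw [← sq_abs, ← Real.sq_sqrt hK]; gcongr
    have h6 : (t + r) ^ 2 ≤ (2 * r + √K) ^ 2 :=
      pow_le_pow_left₀ (by positivity) (by linarith [(abs_le.1 h4).2]) 2
    have h7 := mul_le_mul h5 h6 (sq_nonneg _) hK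
    nlinarith
  rw [integral_add (hint _) (hint _), integral_add (hint _) (hint _), integral_const_mul,
    integral_sub (hint _) (hint _)] at h1
  simp only [integral_const, probReal_univ, one_smul] at h1
  have h2 := integral_norm_sq_perp_next_le hn hs ha hr hδ0 hδ hδ' q
  have h3 : 2 * r ^ 2 * (∫ ω, ‖perp (toVec (next q ω))‖ ^ 2
      ∂(slot service arrival route q).toMeasure - r ^ 2) ≤ 2 * r ^ 2 * (K - 2 * (δ * r)) :=
    mul_le_mul_of_nonneg_left (by linarith) (by positivity)
  linarith [hb r hr0]

end LoadBalancing

namespace PMF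

theorem measurePreserving_map {α β : Type*} [MeasurableSpace α] [MeasurableSpace β]
    [DiscreteMeasurableSpace α] (p : PMF α) (g : α → β) :
    MeasurePreserving g p.toMeasure (p.map g).toMeasure :=
  ⟨.of_discrete, PMF.toMeasure_map (f := g) (p := p) (hf := Measurable.of_discrete)⟩

end PMF

theorem MeasureTheory.MeasurePreserving.integral_comp_of_discrete {α β : Type*}
    [MeasurableSpace α] [MeasurableSpace β] [Countable β] [DiscreteMeasurableSpace β]
    {E : Type*} [NormedAddCommGroup E] [NormedSpace ℝ E] {μ : Measure α} {ν : Measure β}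
    {g : α → β} (hg : MeasurePreserving g μ ν) (f : β → E) :
    ∫ x, f (g x) ∂μ = ∫ y, f y ∂ν := by
  rw [← hg.map_eq, integral_map hg.measurable.aemeasurable
    StronglyMeasurable.of_discrete.aestronglyMeasurable]

namespace LoadBalancing

variable {n : ℕ}
variable {service : PMF (Fin n → ℕ)} {arrival : PMF ℕ} {route : Routing n} {Amax Smax : ℕ}
  {π : PMF (Fin n → ℕ)}

/-! ### The stationary slot: net input and unused service. -/

/-- The joint law of the queue lengths and of the next time slot, if the queue lengths have
law `π`. -/
noncomputable def joint (service : PMF (Fin n → ℕ)) (arrival : PMF ℕ) (route : Routing n)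
    (π : PMF (Fin n → ℕ)) : PMF ((Fin n → ℕ) × Fin n × ℕ × (Fin n → ℕ)) :=
  π.bind fun q => (slot service arrival route q).map (Prod.mk q)

theorem measurePreserving_fst : MeasurePreserving (fun z => z.1)
    (joint service arrival route π).toMeasure π.toMeasure := by
  convert PMF.measurePreserving_map (joint service arrival route π) fun z => z.1
  have h : ∀ q, (slot service arrival route q).map (fun _ => q) = PMF.pure q := fun q =>
    PMF.map_const _ _
  simp only [joint, PMF.map_bind, PMF.map_comp, Function.comp_def, h, PMF.bind_pure]

theorem measurePreserving_next (hπ : MarkovChain.IsStationary (step service arrival route) π) :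
    MeasurePreserving (fun z => next z.1 z.2)
      (joint service arrival route π).toMeasure π.toMeasure := by
  convert PMF.measurePreserving_map (joint service arrival route π) fun z => next z.1 z.2
  simp only [joint, PMF.map_bind, PMF.map_comp, Function.comp_def]
  refine Eq.trans (show π.bind (step service arrival route) = π from hπ).symm ?_
  congr 1
  funext q
  exact step_eq_map q

/-- The selected queue depends on the state, but once it is forgotten the arrivals and services are
independent of the state. -/
theorem measurePreserving_noise : MeasurePreserving (fun z => (z.1, z.2.2))
    (joint service arrival route π).toMeasure
    (π.toMeasure.prod (noise service arrival).toMeasure) := by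
  rw [← PMF.toMeasure_bind_map_prodMk]
  convert PMF.measurePreserving_map (joint service arrival route π) fun z => (z.1, z.2.2)
  simp only [joint, slot, PMF.map_bind, PMF.map_comp, Function.comp_def, PMF.bind_const]

theorem mem_support_joint {z : (Fin n → ℕ) × Fin n × ℕ × (Fin n → ℕ)}
    (h : z ∈ (joint service arrival route π).support) :
    z.2.2.1 ∈ arrival.support ∧ z.2.2.2 ∈ service.support := by
  simp only [joint, PMF.mem_support_bind_iff, PMF.mem_support_map_iff] at h
  obtain ⟨q, -, w, hw, rfl⟩ := h
  exact (mem_support_slot hw).2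

/-- The net input of a time slot if no service is wasted. -/
noncomputable def netInput (w : ℕ × (Fin n → ℕ)) : ℝ := w.1 - ∑ j, (w.2 j : ℝ)

/-- The total unused service of a time slot. -/
noncomputable def unused (q : Fin n → ℕ) (ω : Fin n × ℕ × (Fin n → ℕ)) : ℝ :=
  total (next q ω) - (total q + netInput ω.2)

theorem unused_nonneg (q : Fin n → ℕ) (ω : Fin n × ℕ × (Fin n → ℕ)) : 0 ≤ unused q ω := by
  have := le_total_next q ω
  simp only [unused, netInput]; linarith

theorem unused_eq_sum (q : Fin n → ℕ) (ω : Fin n × ℕ × (Fin n → ℕ)) :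
    unused q ω = ∑ j, ((next q ω j : ℝ) -
      ((q j : ℝ) + (if j = ω.1 then (ω.2.1 : ℝ) else 0) - ω.2.2 j)) := by
  have := sum_ite_mul (fun _ => 1) ω.1 (ω.2.1 : ℝ)
  simp only [one_mul] at this
  simp only [unused, netInput, total, Finset.sum_sub_distrib, Finset.sum_add_distrib, this]
  ring

theorem unused_le {ω : Fin n × ℕ × (Fin n → ℕ)} (hs : ∀ j, ω.2.2 j ≤ Smax) (q : Fin n → ℕ) :
    unused q ω ≤ n * Smax := by
  rw [unused_eq_sum]
  calc _ ≤ ∑ _j : Fin n, (Smax : ℝ) := Finset.sum_le_sum fun j _ => ?_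
    _ = _ := by simp
  rw [cast_next]
  have h1 : (ω.2.2 j : ℝ) ≤ Smax := by exact_mod_cast hs j
  have h2 : (0 : ℝ) ≤ q j := by positivity
  have h3 : (0 : ℝ) ≤ if j = ω.1 then (ω.2.1 : ℝ) else 0 := by positivity
  have h4 : (0 : ℝ) ≤ ω.2.2 j := by positivity
  rw [sub_le_iff_le_add]
  exact max_le (by linarith) (by linarith)

theorem abs_sub_le_norm_perp (hn : 0 < n) (y : EuclideanSpace ℝ (Fin n)) (i j : Fin n) :
    |y i - y j| ≤ 2 * ‖perp y‖ := by
  have h : y i - y j = perp y i - perp y j := by rw [perp_apply hn, perp_apply hn]; ring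
  have h1 := PiLp.norm_apply_le (perp y) i
  have h2 := PiLp.norm_apply_le (perp y) j
  rw [h]
  refine (abs_sub _ _).trans ?_
  simp only [Real.norm_eq_abs] at h1 h2
  linarith

/-- Service can be wasted only if some queue is empty after the time slot. -/
theorem total_next_mul_unused_le (hn : 0 < n) (q : Fin n → ℕ) (ω : Fin n × ℕ × (Fin n → ℕ)) :
    total (next q ω) * unused q ω ≤ 2 * n * ‖perp (toVec (next q ω))‖ * unused q ω := by
  by_cases h : ∃ j, next q ω j = 0
  · obtain ⟨j, hj⟩ := h
    refine mul_le_mul_of_nonneg_right ?_ (unused_nonneg q ω)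
    calc total (next q ω) ≤ ∑ _i : Fin n, 2 * ‖perp (toVec (next q ω))‖ := by
          refine Finset.sum_le_sum fun i _ => ?_
          have := (le_abs_self _).trans (abs_sub_le_norm_perp hn (toVec (next q ω)) i j)
          simpa [toVec, hj] using this
      _ = _ := by simp; ring
  · push Not at h
    have : unused q ω = 0 := by
      rw [unused_eq_sum]
      refine Finset.sum_eq_zero fun j _ => ?_
      have hj : (next q ω j : ℝ) ≠ 0 := by exact_mod_cast h j
      rw [cast_next] at hj ⊢
      rcases max_choice ((q j : ℝ) + (if j = ω.1 then (ω.2.1 : ℝ) else 0) - ω.2.2 j) 0 with h' | h'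
      · rw [h', sub_self]
      · exact absurd h' hj
    simp [this]

theorem integral_netInput (hs : ∀ s ∈ service.support, ∀ i, s i ≤ Smax)
    (ha : ∀ a ∈ arrival.support, a ≤ Amax) :
    ∫ w, netInput w ∂(noise service arrival).toMeasure =
      arrivalRate arrival - totalRate service := by
  have hint : ∀ f : ℕ × (Fin n → ℕ) → ℝ, Integrable f (noise service arrival).toMeasure :=
    PMF.integrable_of_finite_support (finite_support_noise hs ha)
  simp only [netInput]
  rw [integral_sub (hint _) (hint _), integral_finsetSum _ fun _ _ => hint _,
    integral_noise_arrival fun a => (a : ℝ), arrivalRate, totalRate]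
  congr 1
  exact Finset.sum_congr rfl fun j _ => integral_noise_service fun s => (s j : ℝ)

theorem integrable_unused (hs : ∀ s ∈ service.support, ∀ i, s i ≤ Smax) :
    Integrable (fun z => unused z.1 z.2) (joint service arrival route π).toMeasure := by
  refine Integrable.of_bound Measurable.of_discrete.aestronglyMeasurable (n * Smax)
    (PMF.ae_of_forall_support fun z hz => ?_)
  rw [Real.norm_eq_abs, abs_of_nonneg (unused_nonneg _ _)]
  exact unused_le (hs _ (mem_support_joint hz).2) _

/-- In steady state the total has the same finite mean before and after the slot, so the mean unused
service offsets the mean net input. -/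
theorem integral_unused (hs : ∀ s ∈ service.support, ∀ i, s i ≤ Smax)
    (ha : ∀ a ∈ arrival.support, a ≤ Amax)
    (hπ : MarkovChain.IsStationary (step service arrival route) π)
    (hint : Integrable total π.toMeasure) :
    ∫ z, unused z.1 z.2 ∂(joint service arrival route π).toMeasure =
      totalRate service - arrivalRate arrival := by
  have hmp := measurePreserving_noise (service := service) (arrival := arrival) (route := route)
    (π := π)
  have hnoise : Integrable (netInput (n := n)) (noise service arrival).toMeasure :=
    PMF.integrable_of_finite_support (finite_support_noise hs ha) _
  have h1 := (measurePreserving_next hπ).integrable_comp_of_integrable hint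
  have h2 := (measurePreserving_fst (service := service) (arrival := arrival) (route := route)
    (π := π)).integrable_comp_of_integrable hint
  have h3 := hmp.integrable_comp_of_integrable (hnoise.comp_snd π.toMeasure)
  simp only [unused]
  simp only [Function.comp_def] at h1 h2 h3
  have h23 : Integrable (fun x => total x.1 + netInput x.2.2)
    (joint service arrival route π).toMeasure := h2.add h3
  rw [integral_sub h1 h23, integral_add h2 h3,
    (measurePreserving_next hπ).integral_comp_of_discrete total,
    measurePreserving_fst.integral_comp_of_discrete total,
    hmp.integral_comp_of_discrete fun w => netInput w.2, integral_fun_snd,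
    integral_netInput hs ha]
  simp

/-- The second moment of the net input. -/
theorem integral_netInput_sq (hs : ∀ s ∈ service.support, ∀ i, s i ≤ Smax)
    (ha : ∀ a ∈ arrival.support, a ≤ Amax) :
    ∫ w, netInput w ^ 2 ∂(noise service arrival).toMeasure =
      arrivalStd arrival ^ 2 + ∑ i, ∑ j, serviceCov service i j +
        (totalRate service - arrivalRate arrival) ^ 2 := by
  have hint : ∀ f : ℕ × (Fin n → ℕ) → ℝ, Integrable f (noise service arrival).toMeasure :=
    PMF.integrable_of_finite_support (finite_support_noise hs ha)
  have hintA : ∀ f : ℕ → ℝ, MemLp f 2 arrival.toMeasure := fun f =>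
    (memLp_two_iff_integrable_sq Measurable.of_discrete.aestronglyMeasurable).2
      (PMF.integrable_of_finite_support (finite_support_arrival ha) _)
  have hintS : ∀ f : (Fin n → ℕ) → ℝ, MemLp f 2 service.toMeasure := fun f =>
    (memLp_two_iff_integrable_sq Measurable.of_discrete.aestronglyMeasurable).2
      (PMF.integrable_of_finite_support (finite_support_service hs) _)
  have hvar : arrivalStd arrival ^ 2 =
      ∫ a, (a : ℝ) ^ 2 ∂arrival.toMeasure - arrivalRate arrival ^ 2 := by
    rw [arrivalStd, Real.sq_sqrt (variance_nonneg _ _), variance_eq_sub (hintA _), arrivalRate]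
    rfl
  have hcov : ∑ i, ∑ j, serviceCov service i j =
      ∫ s, (∑ j, (s j : ℝ)) ^ 2 ∂service.toMeasure - totalRate service ^ 2 := by
    have h1 : ∀ i j, serviceCov service i j = ∫ s, (s i : ℝ) * s j ∂service.toMeasure -
        serviceRate service i * serviceRate service j := fun i j => by
      rw [serviceCov, covariance_eq_sub (hintS _) (hintS _)]; rfl
    simp only [h1, Finset.sum_sub_distrib, totalRate, sq, Finset.sum_mul_sum]
    rw [integral_finsetSum _ fun _ _ => (hintS _).integrable one_le_two]
    congr 1
    refine Finset.sum_congr rfl fun i _ => ?_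
    rw [integral_finsetSum _ fun _ _ => (hintS _).integrable one_le_two]
  have hprod : ∫ w, (w.1 : ℝ) * ∑ j, (w.2 j : ℝ) ∂(noise service arrival).toMeasure =
      arrivalRate arrival * totalRate service := by
    rw [noise_toMeasure, integral_prod_mul (fun a : ℕ => (a : ℝ))
      (fun s : Fin n → ℕ => ∑ j, (s j : ℝ)),
      integral_finsetSum _ fun _ _ => (hintS _).integrable one_le_two]
    rfl
  have hexp : ∀ w : ℕ × (Fin n → ℕ), netInput w ^ 2 =
      (w.1 : ℝ) ^ 2 - 2 * ((w.1 : ℝ) * ∑ j, (w.2 j : ℝ)) + (∑ j, (w.2 j : ℝ)) ^ 2 := fun w => by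
    rw [netInput]; ring
  simp only [hexp]
  rw [integral_add (hint _) (hint _), integral_sub (hint _) (hint _), integral_const_mul, hprod,
    integral_noise_arrival fun a => (a : ℝ) ^ 2,
    integral_noise_service fun s => (∑ j, (s j : ℝ)) ^ 2, hvar, hcov]
  ring

theorem sum_serviceCov_nonneg (hs : ∀ s ∈ service.support, ∀ i, s i ≤ Smax) :
    0 ≤ ∑ i, ∑ j, serviceCov service i j := by
  have hintS : ∀ f : (Fin n → ℕ) → ℝ, MemLp f 2 service.toMeasure := fun f =>
    (memLp_two_iff_integrable_sq Measurable.of_discrete.aestronglyMeasurable).2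
      (PMF.integrable_of_finite_support (finite_support_service hs) _)
  simp only [serviceCov]
  rw [← covariance_fun_sum_fun_sum (fun _ => hintS _) (fun _ => hintS _), covariance_self
    Measurable.of_discrete.aemeasurable]
  exact variance_nonneg _ _

/-! ### The balance equation for characteristic functions. -/

/-- `e^{ix}`. -/
noncomputable def phase (x : ℝ) : ℂ := Complex.exp (Complex.I * x)

theorem norm_phase (x : ℝ) : ‖phase x‖ = 1 := by
  rw [phase, mul_comm]; exact Complex.norm_exp_ofReal_mul_I x

theorem phase_add (x y : ℝ) : phase (x + y) = phase x * phase y := by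
  rw [phase, phase, phase, ← Complex.exp_add]; push_cast; ring_nf

theorem continuous_phase : Continuous phase := by unfold phase; fun_prop

theorem norm_phase_sub_one_le (x : ℝ) : ‖phase x - 1‖ ≤ |x| :=
  Real.norm_exp_I_mul_ofReal_sub_one_le

theorem norm_phase_sub_phase_le (x y : ℝ) : ‖phase x - phase y‖ ≤ |x - y| := by
  have : phase x - phase y = phase y * (phase (x - y) - 1) := by
    rw [mul_sub, ← phase_add]; simp
  rw [this, norm_mul, norm_phase, one_mul]
  exact norm_phase_sub_one_le _

theorem norm_phase_sub_linear_le {x : ℝ} (hx : |x| ≤ 1) :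
    ‖phase x - 1 - Complex.I * x‖ ≤ x ^ 2 := by
  have := Complex.norm_exp_sub_one_sub_id_le (x := Complex.I * x) (by simpa using hx)
  simpa [phase] using this

theorem norm_phase_sub_quadratic_le {x : ℝ} (hx : |x| ≤ 1) :
    ‖phase x - 1 - Complex.I * x + x ^ 2 / 2‖ ≤ |x| ^ 3 := by
  have := Complex.exp_bound (x := Complex.I * x) (by simpa using hx) (n := 3) (by norm_num)
  have h1 : phase x - ∑ m ∈ Finset.range 3, (Complex.I * (x : ℂ)) ^ m / (m.factorial : ℂ) =
      phase x - 1 - Complex.I * x + x ^ 2 / 2 := by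
    simp [Finset.sum_range_succ, mul_pow]; ring
  rw [← h1]
  refine this.trans ?_
  rw [norm_mul, Complex.norm_I, one_mul, Complex.norm_real, Real.norm_eq_abs]
  have : 0 ≤ |x| ^ 3 := by positivity
  norm_num [Nat.factorial]
  linarith

theorem integrable_phase {α : Type*} [MeasurableSpace α] {μ : Measure α} [IsProbabilityMeasure μ]
    {f : α → ℝ} (hf : Measurable f) : Integrable (fun x => phase (f x)) μ :=
  Integrable.of_bound (continuous_phase.measurable.comp hf).aestronglyMeasurable 1
    (.of_forall fun _ => (norm_phase _).le)

theorem norm_integral_phase_le {α : Type*} [MeasurableSpace α] {μ : Measure α}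
    [IsProbabilityMeasure μ] (f : α → ℝ) : ‖∫ x, phase (f x) ∂μ‖ ≤ 1 :=
  (norm_integral_le_of_norm_le_const (.of_forall fun _ => (norm_phase _).le)).trans (by simp)

/-- `N` stands for the total after the slot, `U` for the unused service, `r` for `‖q_⊥‖` after the
slot. The errors are of order `x² U²` and `x² N U`, the latter controlled by `r U`. The free weight
`h` in `2r ≤ h r² + 1 / h` separates `r` from `U`, so that only `𝔼[r²]` and `𝔼[U]` are needed. -/
theorem norm_phase_mul_phase_sub_le {x N U r h B k : ℝ} (hk : 0 ≤ k) (hh : 0 < h) (hN0 : 0 ≤ N)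
    (hU0 : 0 ≤ U) (hUB : U ≤ B) (hNU : N * U ≤ 2 * k * r * U) (hx : |x| * B ≤ 1) :
    ‖phase (x * N) * phase (-(x * U)) - phase (x * N) + Complex.I * ((x * U : ℝ) : ℂ)‖ ≤
      x ^ 2 * (B * U + k * (B * h * r ^ 2 + U / h)) := by
  have hxU : |-(x * U)| ≤ 1 := by
    rw [abs_neg, abs_mul, abs_of_nonneg hU0]
    exact (mul_le_mul_of_nonneg_left hUB (abs_nonneg x)).trans hx
  have hdec : phase (x * N) * phase (-(x * U)) - phase (x * N) + Complex.I * ((x * U : ℝ) : ℂ) =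
      phase (x * N) * (phase (-(x * U)) - 1 - Complex.I * ((-(x * U) : ℝ) : ℂ)) -
        Complex.I * ((x * U : ℝ) : ℂ) * (phase (x * N) - 1) := by
    push_cast; ring
  have h1 : ‖phase (x * N) * (phase (-(x * U)) - 1 - Complex.I * ((-(x * U) : ℝ) : ℂ))‖ ≤
      x ^ 2 * U ^ 2 := by
    rw [norm_mul, norm_phase, one_mul]
    exact (norm_phase_sub_linear_le hxU).trans_eq (by ring)
  have h2 : ‖Complex.I * ((x * U : ℝ) : ℂ) * (phase (x * N) - 1)‖ ≤ x ^ 2 * (N * U) := by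
    rw [norm_mul, norm_mul, Complex.norm_I, one_mul, Complex.norm_real, Real.norm_eq_abs]
    refine (mul_le_mul_of_nonneg_left (norm_phase_sub_one_le _) (abs_nonneg _)).trans_eq ?_
    rw [abs_mul, abs_mul, abs_of_nonneg hU0, abs_of_nonneg hN0, ← sq_abs x]; ring
  have h3 : 2 * r * U ≤ B * h * r ^ 2 + U / h := by
    have h4 : 2 * r ≤ h * r ^ 2 + 1 / h := by
      have : 0 ≤ (h * r - 1) ^ 2 / h := by positivity
      have h5 : (h * r - 1) ^ 2 / h = h * r ^ 2 - 2 * r + 1 / h := by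
        field_simp; ring
      linarith
    have h5 := mul_le_mul_of_nonneg_right h4 hU0
    have h6 := mul_le_mul_of_nonneg_right hUB (show 0 ≤ h * r ^ 2 by positivity)
    have h7 : 1 / h * U = U / h := by ring
    linarith
  have h4 : U ^ 2 ≤ B * U := by
    rw [sq]; exact mul_le_mul_of_nonneg_right hUB hU0
  have h5 := mul_le_mul_of_nonneg_left h3 hk
  rw [hdec]
  refine (norm_sub_le _ _).trans ((add_le_add h1 h2).trans ?_)
  rw [← mul_add]
  refine mul_le_mul_of_nonneg_left ?_ (sq_nonneg x)
  linarith

/-- The stationarity of `e^{ix∑q}`: the net input is balanced by the unused service, up to an error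
that is controlled by the distance to the diagonal. -/
theorem norm_integral_phase_total_le (hn : 0 < n) (hs : ∀ s ∈ service.support, ∀ i, s i ≤ Smax)
    (ha : ∀ a ∈ arrival.support, a ≤ Amax)
    (hπ : MarkovChain.IsStationary (step service arrival route) π)
    (hint : Integrable total π.toMeasure) {b h x : ℝ} (hh : 0 < h)
    (hperp : Integrable (fun q => ‖perp (toVec q)‖ ^ 2) π.toMeasure)
    (hb : ∫ q, ‖perp (toVec q)‖ ^ 2 ∂π.toMeasure ≤ b) (hx : |x| * (n * Smax) ≤ 1) :
    ‖(∫ q, phase (x * total q) ∂π.toMeasure) *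
        (∫ w, phase (x * netInput w) ∂(noise service arrival).toMeasure - 1) +
        Complex.I * (x * (totalRate service - arrivalRate arrival) : ℝ)‖ ≤
      x ^ 2 * (n * Smax * (totalRate service - arrivalRate arrival) +
        n * (n * Smax * h * b + (totalRate service - arrivalRate arrival) / h)) := by
  set Γ := (joint service arrival route π).toMeasure with hΓ
  set U : (Fin n → ℕ) × Fin n × ℕ × (Fin n → ℕ) → ℝ := fun z => unused z.1 z.2 with hU
  set N : (Fin n → ℕ) × Fin n × ℕ × (Fin n → ℕ) → ℝ := fun z => total (next z.1 z.2) with hN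
  set r : (Fin n → ℕ) × Fin n × ℕ × (Fin n → ℕ) → ℝ :=
    fun z => ‖perp (toVec (next z.1 z.2))‖ with hr
  have hUint : Integrable U Γ := integrable_unused hs
  have hUmean : ∫ z, U z ∂Γ = totalRate service - arrivalRate arrival :=
    integral_unused hs ha hπ hint
  have hrint : Integrable (fun z => r z ^ 2) Γ := by
    have h := (measurePreserving_next hπ).integrable_comp_of_integrable hperp
    exact h
  have hrmean : ∫ z, r z ^ 2 ∂Γ ≤ b := by
    have h := (measurePreserving_next hπ).integral_comp_of_discrete fun q => ‖perp (toVec q)‖ ^ 2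
    exact h.trans_le hb
  have hφ : ∫ z, phase (x * N z) ∂Γ = ∫ q, phase (x * total q) ∂π.toMeasure :=
    (measurePreserving_next hπ).integral_comp_of_discrete fun q => phase (x * total q)
  -- `N - U` is the old total plus the net input, which are independent, so the integral factors.
  have hφM : ∫ z, phase (x * N z) * phase (-(x * U z)) ∂Γ =
      (∫ q, phase (x * total q) ∂π.toMeasure) *
        ∫ w, phase (x * netInput w) ∂(noise service arrival).toMeasure := by
    rw [← integral_prod_mul, ← measurePreserving_noise.integral_comp_of_discrete
      (fun z => phase (x * total z.1) * phase (x * netInput z.2))]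
    refine integral_congr_ae (.of_forall fun z => ?_)
    simp only [← phase_add, hN, hU, unused]
    congr 1; ring
  have hNint : Integrable (fun z => phase (x * N z)) Γ := integrable_phase .of_discrete
  have hNUint : Integrable (fun z => phase (x * N z) * phase (-(x * U z))) Γ := by
    simp only [← phase_add]; exact integrable_phase .of_discrete
  have hUint' : Integrable (fun z => Complex.I * ((x * U z : ℝ) : ℂ)) Γ :=
    ((hUint.const_mul x).ofReal).const_mul _
  have hsub : Integrable (fun z => phase (x * N z) * phase (-(x * U z)) - phase (x * N z)) Γ :=
    hNUint.sub hNint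
  have hmain : (∫ q, phase (x * total q) ∂π.toMeasure) *
        (∫ w, phase (x * netInput w) ∂(noise service arrival).toMeasure - 1) +
        Complex.I * (x * (totalRate service - arrivalRate arrival) : ℝ) =
      ∫ z, (phase (x * N z) * phase (-(x * U z)) - phase (x * N z) +
        Complex.I * ((x * U z : ℝ) : ℂ)) ∂Γ := by
    rw [integral_add hsub hUint', integral_sub hNUint hNint, hφ, hφM,
      integral_const_mul, integral_complex_ofReal, integral_const_mul, hUmean]
    ring
  rw [hmain]
  have hpt : ∀ᵐ z ∂Γ, ‖phase (x * N z) * phase (-(x * U z)) - phase (x * N z) +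
      Complex.I * ((x * U z : ℝ) : ℂ)‖ ≤
      x ^ 2 * (n * Smax * U z + n * (n * Smax * h * r z ^ 2 + U z / h)) := by
    refine PMF.ae_of_forall_support fun z hz => ?_
    exact norm_phase_mul_phase_sub_le (Nat.cast_nonneg n) hh (total_nonneg _) (unused_nonneg _ _)
      (unused_le (hs _ (mem_support_joint hz).2) _) (total_next_mul_unused_le hn _ _) hx
  have hI1 : Integrable (fun z => n * Smax * U z) Γ := hUint.const_mul _
  have hI2 : Integrable (fun z => n * Smax * h * r z ^ 2) Γ := hrint.const_mul _
  have hI3 : Integrable (fun z => U z / h) Γ := hUint.div_const _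
  have hI4 : Integrable (fun z => n * (n * Smax * h * r z ^ 2 + U z / h)) Γ :=
    (hI2.add hI3).const_mul _
  refine (norm_integral_le_of_norm_le ((hI1.add hI4).const_mul _) hpt).trans ?_
  rw [integral_const_mul, integral_add' hI1 hI4, integral_const_mul, integral_const_mul,
    integral_add hI2 hI3, integral_const_mul, integral_div, hUmean]
  gcongr

theorem abs_netInput_le {w : ℕ × (Fin n → ℕ)} (ha : w.1 ≤ Amax) (hs : ∀ j, w.2 j ≤ Smax) :
    |netInput w| ≤ Amax + n * Smax := by
  have h1 : ∑ j, (w.2 j : ℝ) ≤ n * Smax := by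
    calc ∑ j, (w.2 j : ℝ) ≤ ∑ _j : Fin n, (Smax : ℝ) :=
          Finset.sum_le_sum fun j _ => by exact_mod_cast hs j
      _ = _ := by simp
  have h2 : (w.1 : ℝ) ≤ Amax := by exact_mod_cast ha
  have h3 : 0 ≤ ∑ j, (w.2 j : ℝ) := by positivity
  have h4 : (0 : ℝ) ≤ w.1 := by positivity
  rw [netInput, abs_le]
  constructor <;> linarith

theorem norm_integral_phase_netInput_le (hs : ∀ s ∈ service.support, ∀ i, s i ≤ Smax)
    (ha : ∀ a ∈ arrival.support, a ≤ Amax) {x : ℝ} (hx : |x| * (Amax + n * Smax) ≤ 1) :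
    ‖∫ w, phase (x * netInput w) ∂(noise service arrival).toMeasure - 1 +
        Complex.I * (x * (totalRate service - arrivalRate arrival) : ℝ) +
        ((x ^ 2 / 2 * (arrivalStd arrival ^ 2 + ∑ i, ∑ j, serviceCov service i j +
          (totalRate service - arrivalRate arrival) ^ 2) : ℝ) : ℂ)‖ ≤
      (|x| * (Amax + n * Smax)) ^ 3 := by
  have hint : ∀ f : ℕ × (Fin n → ℕ) → ℂ, Integrable f (noise service arrival).toMeasure :=
    PMF.integrable_of_finite_support (finite_support_noise hs ha)
  have hmean := integral_netInput hs ha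
  have heq : ∫ w, phase (x * netInput w) ∂(noise service arrival).toMeasure - 1 +
        Complex.I * (x * (totalRate service - arrivalRate arrival) : ℝ) +
        ((x ^ 2 / 2 * (arrivalStd arrival ^ 2 + ∑ i, ∑ j, serviceCov service i j +
          (totalRate service - arrivalRate arrival) ^ 2) : ℝ) : ℂ) =
      ∫ w, (phase (x * netInput w) - 1 - Complex.I * ((x * netInput w : ℝ) : ℂ) +
        ((x ^ 2 / 2 * netInput w ^ 2 : ℝ) : ℂ)) ∂(noise service arrival).toMeasure := by
    rw [integral_add (hint _) (hint _), integral_sub (hint _) (hint _),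
      integral_sub (hint _) (hint _), integral_const_mul, integral_complex_ofReal,
      integral_complex_ofReal, integral_const_mul, integral_const_mul,
      integral_netInput_sq hs ha, hmean]
    simp only [integral_const, probReal_univ, one_smul]
    push_cast; ring
  rw [heq]
  refine (norm_integral_le_of_norm_le_const (C := (|x| * (Amax + n * Smax)) ^ 3)
    (PMF.ae_of_forall_support fun w hw => ?_)).trans (by simp)
  obtain ⟨h1, h2⟩ := mem_support_noise hw
  have h3 : |x * netInput w| ≤ |x| * (Amax + n * Smax) := by
    rw [abs_mul]
    exact mul_le_mul_of_nonneg_left (abs_netInput_le (ha _ h1) (hs _ h2)) (abs_nonneg x)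
  have h4 := norm_phase_sub_quadratic_le (h3.trans hx)
  refine le_trans (le_of_eq ?_) (h4.trans (pow_le_pow_left₀ (abs_nonneg _) h3 3))
  congr 1; push_cast; ring

/-- The balance equation at `x = τ ε`, with the net input expanded to second order, divided by `ε²`.
The weight `h = √ε` balances `h 𝔼[r²]` against `𝔼[U] / h = ε / h`. -/
theorem norm_integral_phase_mul_sub_le (hn : 0 < n)
    (hs : ∀ s ∈ service.support, ∀ i, s i ≤ Smax)
    (ha : ∀ a ∈ arrival.support, a ≤ Amax)
    (hπ : MarkovChain.IsStationary (step service arrival route) π)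
    (hint : Integrable total π.toMeasure) {b ε τ : ℝ} (hε : 0 < ε)
    (hmean : arrivalRate arrival = totalRate service - ε)
    (hperp : Integrable (fun q => ‖perp (toVec q)‖ ^ 2) π.toMeasure)
    (hb : ∫ q, ‖perp (toVec q)‖ ^ 2 ∂π.toMeasure ≤ b)
    (hτ : |τ| * ε * (Amax + n * Smax) ≤ 1) :
    ‖(∫ q, phase (τ * ε * total q) ∂π.toMeasure) * (Complex.I * τ +
        ((τ ^ 2 / 2 * (arrivalStd arrival ^ 2 + ∑ i, ∑ j, serviceCov service i j + ε ^ 2) : ℝ) : ℂ))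
        - Complex.I * τ‖ ≤
      τ ^ 2 * (n * Smax * ε + n * (n * Smax * b + 1) * √ε) +
        (|τ| * (Amax + n * Smax)) ^ 3 * ε := by
  have hx : |τ * ε| * (Amax + n * Smax) ≤ 1 := by rwa [abs_mul, abs_of_pos hε]
  have hx' : |τ * ε| * (n * Smax) ≤ 1 := by
    refine le_trans (mul_le_mul_of_nonneg_left ?_ (abs_nonneg _)) hx
    linarith [Nat.cast_nonneg (α := ℝ) Amax]
  have h1 := norm_integral_phase_total_le hn hs ha hπ hint (Real.sqrt_pos.2 hε) hperp hb hx'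
  have h2 := norm_integral_phase_netInput_le hs ha hx
  have he : totalRate service - arrivalRate arrival = ε := by rw [hmean]; ring
  rw [he] at h1 h2
  set φ := ∫ q, phase (τ * ε * total q) ∂π.toMeasure
  set M := ∫ w, phase (τ * ε * netInput w) ∂(noise service arrival).toMeasure
  set v := arrivalStd arrival ^ 2 + ∑ i, ∑ j, serviceCov service i j + ε ^ 2
  have hφ : ‖φ‖ ≤ 1 := norm_integral_phase_le _
  set X := M - 1 + Complex.I * (τ * ε * ε : ℝ) + (((τ * ε) ^ 2 / 2 * v : ℝ) : ℂ) with hX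
  set Y := φ * (M - 1) + Complex.I * (τ * ε * ε : ℝ) with hY
  have hkey : (ε ^ 2 : ℂ) * (φ * (Complex.I * τ + ((τ ^ 2 / 2 * v : ℝ) : ℂ)) - Complex.I * τ) =
      φ * X - Y := by
    rw [hX, hY]; push_cast; ring
  have h3 : ‖φ * X - Y‖ ≤ (|τ * ε| * (Amax + n * Smax)) ^ 3 + (τ * ε) ^ 2 * (n * Smax * ε +
      n * (n * Smax * √ε * b + ε / √ε)) := by
    refine (norm_sub_le _ _).trans (add_le_add ?_ h1)
    rw [norm_mul]
    exact (mul_le_mul hφ h2 (norm_nonneg _) zero_le_one).trans_eq (one_mul _)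
  rw [← hkey, norm_mul, norm_pow, Complex.norm_real, Real.norm_eq_abs, sq_abs,
    Real.div_sqrt, abs_mul, abs_of_pos hε] at h3
  refine le_of_mul_le_mul_left (h3.trans_eq ?_) (pow_pos hε 2)
  ring

/-! ### The exponential law and convergence in distribution. -/

theorem integral_phase_expMeasure {r : ℝ} (hr : 0 < r) (t : ℝ) :
    ∫ x, phase (t * x) ∂(expMeasure r) = 1 / (1 - Complex.I * t * (r⁻¹ : ℝ)) := by
  have hden : expMeasure r = volume.withDensity (exponentialPDF r) := rfl
  have hre : (Complex.I * t - r).re < 0 := by simpa using hr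
  have hne : (Complex.I * t - r : ℂ) ≠ 0 := fun h => by simp [h] at hre
  rw [hden, integral_withDensity_eq_integral_toReal_smul (f := exponentialPDF r)
    (measurable_exponentialPDFReal r).ennreal_ofReal (by simp [exponentialPDF])]
  have h1 : ∀ x : ℝ, (exponentialPDF r x).toReal • phase (t * x) =
      (Ici (0 : ℝ)).indicator (fun x : ℝ => (r : ℂ) * Complex.exp ((Complex.I * t - r) * x)) x := by
    intro x
    by_cases hx : 0 ≤ x
    · rw [indicator_of_mem (show x ∈ Ici (0 : ℝ) from hx), exponentialPDF_of_nonneg hx,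
        ENNReal.toReal_ofReal (by positivity), phase, Complex.real_smul]
      push_cast
      rw [mul_assoc, ← Complex.exp_add]
      congr 2; ring
    · rw [indicator_of_notMem (show x ∉ Ici (0 : ℝ) from hx), exponentialPDF_of_neg (not_le.1 hx)]
      simp
  simp only [h1]
  rw [integral_indicator measurableSet_Ici, integral_Ici_eq_integral_Ioi, integral_const_mul,
    integral_exp_mul_complex_Ioi hre]
  have hr' : (r : ℂ) ≠ 0 := by exact_mod_cast hr.ne'
  have hne' : (1 - Complex.I * t * (r⁻¹ : ℝ) : ℂ) ≠ 0 := by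
    intro h
    apply hne
    push_cast at h
    field_simp at h
    linear_combination -h
  rw [eq_div_iff hne']
  push_cast
  simp only [mul_zero, Complex.exp_zero]
  field_simp
  ring

theorem integral_phase_expLaw {m : ℝ} (hm : 0 ≤ m) (t : ℝ) :
    ∫ x, phase (t * x) ∂(expLaw m) = 1 / (1 - Complex.I * t * m) := by
  rcases hm.eq_or_lt with rfl | hm
  · simp [expLaw, phase]
  · rw [expLaw, if_pos hm, integral_phase_expMeasure (inv_pos.2 hm), inv_inv]

/-- Boundedness of `φ` allows `d` to be replaced by its limit, without assuming that `φ` converges.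
-/
theorem tendsto_of_mul_tendsto {ι : Type*} {l : Filter ι} {φ d : ι → ℂ} {d₀ c : ℂ} {e : ι → ℝ}
    (hφ : ∀ i, ‖φ i‖ ≤ 1) (hd : Tendsto d l (𝓝 d₀)) (hd₀ : d₀ ≠ 0) (he : Tendsto e l (𝓝 0))
    (h : ∀ᶠ i in l, ‖φ i * d i - c‖ ≤ e i) : Tendsto φ l (𝓝 (c / d₀)) := by
  have h1 : Tendsto (fun i => φ i * d i - c) l (𝓝 0) := squeeze_zero_norm' h he
  have h2 : Tendsto (fun i => φ i * (d i - d₀)) l (𝓝 0) := by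
    refine squeeze_zero_norm (a := fun i => ‖d i - d₀‖) (fun i => ?_) ?_
    · rw [norm_mul]; exact mul_le_of_le_one_left (norm_nonneg _) (hφ i)
    · simpa using (hd.sub_const d₀).norm
  have h3 : Tendsto (fun i => (φ i * d i - c - φ i * (d i - d₀) + c) / d₀) l
      (𝓝 ((0 - 0 + c) / d₀)) := ((h1.sub h2).add_const c).div_const d₀
  simp only [sub_zero, zero_add] at h3
  refine h3.congr fun i => ?_
  field_simp
  ring

theorem charFun_map_eq_integral_phase {Ω : Type*} [MeasurableSpace Ω] {E : Type*}
    [NormedAddCommGroup E] [InnerProductSpace ℝ E] [MeasurableSpace E] [BorelSpace E]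
    [SecondCountableTopology E] {ν : Measure Ω} {Y : Ω → E} (hY : Measurable Y) (ξ : E) :
    charFun (ν.map Y) ξ = ∫ ω, phase (inner ℝ (Y ω) ξ) ∂ν := by
  rw [charFun_apply, integral_map hY.aemeasurable (by fun_prop)]
  simp only [phase, mul_comm Complex.I]

/-- The weak convergence of the laws of random vectors follows from the convergence of their
characteristic functions. -/
theorem tendstoInDistribution_of_tendsto_phase {Ω Ω' : Type*} [MeasurableSpace Ω]
    [MeasurableSpace Ω'] {E : Type*} [NormedAddCommGroup E] [InnerProductSpace ℝ E]
    [FiniteDimensional ℝ E] [MeasurableSpace E] [BorelSpace E] {ι : Type*} {l : Filter ι}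
    [l.IsCountablyGenerated] {X : ι → Ω → E} {Z : Ω' → E} {μ : ι → Measure Ω} {μ' : Measure Ω'}
    [∀ i, IsProbabilityMeasure (μ i)] [IsProbabilityMeasure μ']
    (hX : ∀ i, Measurable (X i)) (hZ : Measurable Z)
    (h : ∀ ξ, Tendsto (fun i => ∫ ω, phase (inner ℝ (X i ω) ξ) ∂μ i) l
      (𝓝 (∫ ω, phase (inner ℝ (Z ω) ξ) ∂μ'))) :
    TendstoInDistribution X l Z μ μ' := by
  refine ⟨fun i => (hX i).aemeasurable, hZ.aemeasurable, ?_⟩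
  -- Lévy's theorem is applied along sequences, which suffice as `l` is countably generated.
  refine tendsto_iff_seq_tendsto.2 fun u hu => ?_
  refine ProbabilityMeasure.tendsto_of_tendsto_charFun fun ξ => ?_
  rw [ProbabilityMeasure.coe_mk, charFun_map_eq_integral_phase hZ]
  exact ((h ξ).comp hu).congr fun k => (charFun_map_eq_integral_phase (hX (u k)) ξ).symm

theorem inner_toVec (hn : 0 < n) (q : Fin n → ℕ) (ξ : EuclideanSpace ℝ (Fin n)) :
    inner ℝ (toVec q) ξ = (∑ i, ξ i) / n * total q + inner ℝ (perp (toVec q)) ξ := by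
  have h : toVec q = (total q / n) • oneVec n + perp (toVec q) := by
    rw [perp, starProjection_diagonal hn]; simp [toVec, total]
  conv_lhs => rw [h]
  rw [inner_add_left, inner_smul_left]
  simp [oneVec, PiLp.inner_apply]
  ring

/-- The phase is `1`-Lipschitz, so replacing `q` by its projection costs at most `ε ‖ξ‖ 𝔼‖q_⊥‖`, and
`r ≤ 1 + r²`. -/
theorem norm_integral_phase_inner_sub_le (hn : 0 < n)
    (hperp : Integrable (fun q => ‖perp (toVec q)‖ ^ 2) π.toMeasure) {b ε : ℝ} (hε : 0 ≤ ε)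
    (hb : ∫ q, ‖perp (toVec q)‖ ^ 2 ∂π.toMeasure ≤ b) (ξ : EuclideanSpace ℝ (Fin n)) :
    ‖∫ q, phase (inner ℝ (ε • toVec q) ξ) ∂π.toMeasure -
      ∫ q, phase ((∑ i, ξ i) / n * ε * total q) ∂π.toMeasure‖ ≤ ε * (‖ξ‖ * (1 + b)) := by
  rw [← integral_sub (integrable_phase .of_discrete) (integrable_phase .of_discrete)]
  have hint : Integrable (fun q : Fin n → ℕ => ε * (‖ξ‖ * (1 + ‖perp (toVec q)‖ ^ 2)))
      π.toMeasure := ((((integrable_const 1).add hperp).const_mul _).const_mul _)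
  refine (norm_integral_le_of_norm_le hint (.of_forall fun q => ?_)).trans ?_
  · refine (norm_phase_sub_phase_le _ _).trans ?_
    have h1 : inner ℝ (ε • toVec q) ξ - (∑ i, ξ i) / n * ε * total q =
        ε * inner ℝ (perp (toVec q)) ξ := by
      rw [real_inner_smul_left, inner_toVec hn]; ring
    rw [h1, abs_mul, abs_of_nonneg hε]
    refine mul_le_mul_of_nonneg_left ((abs_real_inner_le_norm _ _).trans ?_) hε
    rw [mul_comm]
    refine mul_le_mul_of_nonneg_left ?_ (norm_nonneg _)
    nlinarith [sq_nonneg (‖perp (toVec q)‖ - 1)]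
  · rw [integral_const_mul, integral_const_mul, integral_add (integrable_const 1) hperp]
    simp only [integral_const, probReal_univ, one_smul]
    gcongr

/-! ### Constants uniform in `ε`, and the main theorem. -/

/-- A constant `η₀` such that `e^{η₀ ε ‖q̄‖}` has a finite mean; `μ₀` is a lower bound of the
service rates and `μ` is the total rate. -/
noncomputable def expRate (n Amax Smax : ℕ) (μ₀ μ : ℝ) : ℝ :=
  min 1 (μ₀ / 4) / ((jumpSq n Amax Smax + 1) * μ)

theorem expRate_pos (n Amax Smax : ℕ) {μ₀ μ : ℝ} (hμ₀ : 0 < μ₀) (hμ : 0 < μ) :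
    0 < expRate n Amax Smax μ₀ μ := by
  have := jumpSq_nonneg n Amax Smax
  unfold expRate; positivity

/-- The drift constant `δ = ε μ₀ / μ_Σ` is linear in `ε`, so the exponential rate can be taken
linear in `ε` too; this is why one `Θ` serves all `ε`. -/
theorem drift_params {μ₀ : ℝ} (hμ₀ : 0 < μ₀)
    (hμ : ∀ j, μ₀ ≤ serviceRate service j) {ε : ℝ} (hε : ε ∈ Ioo 0 (totalRate service)) :
    0 < ε * μ₀ / totalRate service ∧ (∀ j, ε * μ₀ / totalRate service ≤ serviceRate service j) ∧
      n * (ε * μ₀ / totalRate service) ≤ ε := by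
  have hT : 0 < totalRate service := hε.1.trans hε.2
  have hnμ : n * μ₀ ≤ totalRate service := by
    calc n * μ₀ = ∑ _j : Fin n, μ₀ := by simp
      _ ≤ _ := Finset.sum_le_sum fun j _ => hμ j
  refine ⟨div_pos (mul_pos hε.1 hμ₀) hT, fun j => ?_, ?_⟩
  · refine le_trans ?_ (hμ j)
    rw [div_le_iff₀ hT]
    nlinarith [hε.2]
  · rw [mul_div_assoc', div_le_iff₀ hT]
    nlinarith [hε.1]

theorem integrable_exp_expRate (hn : 0 < n) (hs : ∀ s ∈ service.support, ∀ i, s i ≤ Smax)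
    (ha : ∀ a ∈ arrival.support, a ≤ Amax) (hr : IsJSQ route) {μ₀ : ℝ} (hμ₀ : 0 < μ₀)
    (hμ : ∀ j, μ₀ ≤ serviceRate service j) {ε : ℝ} (hε : ε ∈ Ioo 0 (totalRate service))
    (hmean : arrivalRate arrival = totalRate service - ε)
    (hπ : MarkovChain.IsStationary (step service arrival route) π) :
    Integrable (fun q => Real.exp (expRate n Amax Smax μ₀ (totalRate service) * ε * ‖toVec q‖))
      π.toMeasure := by
  have hT : 0 < totalRate service := hε.1.trans hε.2
  obtain ⟨h1, h2, h3⟩ := drift_params hμ₀ hμ hε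
  have hK := jumpSq_nonneg n Amax Smax
  have hε0 := hε.1
  set K := jumpSq n Amax Smax with hKdef
  have hη : expRate n Amax Smax μ₀ (totalRate service) * ε =
      min 1 (μ₀ / 4) * ε / ((K + 1) * totalRate service) := by rw [expRate, div_mul_eq_mul_div]
  refine integrable_exp_norm_toVec hn hs ha hr h1 h2 (by rw [hmean]; linarith) hπ
    (mul_pos (expRate_pos _ _ _ hμ₀ hT) hε.1) ?_ ?_
  · have hsqrt : √K ≤ K + 1 := by
      rw [Real.sqrt_le_left (by positivity)]; nlinarith
    rw [hη, div_mul_eq_mul_div, div_le_one (by positivity)]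
    calc min 1 (μ₀ / 4) * ε * √K ≤ 1 * totalRate service * (K + 1) := by
          gcongr
          · exact min_le_left _ _
          · exact hε.2.le
      _ = _ := by ring
  · rw [hη, div_mul_eq_mul_div, div_le_iff₀ (by positivity)]
    calc min 1 (μ₀ / 4) * ε * K ≤ μ₀ / 4 * ε * (K + 1) := by
          gcongr
          · exact min_le_right _ _
          · linarith
      _ = _ := by field_simp

theorem integrable_norm_sq_of_exp {η : ℝ} (hη : 0 < η)
    (h : Integrable (fun q => Real.exp (η * ‖toVec q‖)) π.toMeasure) :
    Integrable (fun q => ‖toVec q‖ ^ 2) π.toMeasure := by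
  refine (h.const_mul (2 / η ^ 2)).mono' Measurable.of_discrete.aestronglyMeasurable
    (.of_forall fun q => ?_)
  have h1 := Real.quadratic_le_exp_of_nonneg (x := η * ‖toVec q‖) (by positivity)
  rw [Real.norm_eq_abs, abs_of_nonneg (by positivity), div_mul_eq_mul_div, le_div_iff₀ (by positivity)]
  nlinarith [mul_nonneg hη.le (norm_nonneg (toVec q))]

theorem integrable_total_of_norm_sq (h : Integrable (fun q => ‖toVec q‖ ^ 2) π.toMeasure) :
    Integrable total π.toMeasure := by
  refine (((integrable_const 1).add h).const_mul (n : ℝ)).mono'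
    Measurable.of_discrete.aestronglyMeasurable (.of_forall fun q => ?_)
  rw [Real.norm_eq_abs, abs_of_nonneg (total_nonneg q)]
  refine (total_le_norm_toVec q).trans (mul_le_mul_of_nonneg_left ?_ (Nat.cast_nonneg n))
  simp only [Pi.add_apply]
  nlinarith [sq_nonneg (‖toVec q‖ - 1)]

end LoadBalancing

theorem corollary1 {n : ℕ} (hn : 0 < n) (Amax Smax : ℕ)
    (service : PMF (Fin n → ℕ))
    (hservice : ∀ s ∈ service.support, ∀ i, s i ≤ Smax)
    (hrate : ∀ i, 0 < LoadBalancing.serviceRate service i)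
    (arrival : ℝ → PMF ℕ)
    (harrival : ∀ ε ∈ Ioo 0 (LoadBalancing.totalRate service),
      ∀ a ∈ (arrival ε).support, a ≤ Amax)
    (hmean : ∀ ε ∈ Ioo 0 (LoadBalancing.totalRate service),
      LoadBalancing.arrivalRate (arrival ε) = LoadBalancing.totalRate service - ε)
    (σa : ℝ)
    (hσa : Tendsto (fun ε => LoadBalancing.arrivalStd (arrival ε)) (𝓝[>] 0) (𝓝 σa))
    (route : ℝ → LoadBalancing.Routing n)
    (hroute : ∀ ε ∈ Ioo 0 (LoadBalancing.totalRate service), LoadBalancing.IsJSQ (route ε)) :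
    (∀ ε ∈ Ioo 0 (LoadBalancing.totalRate service),
      MarkovChain.IsPositiveRecurrent (LoadBalancing.step service (arrival ε) (route ε)) ∧
      ∃ π, MarkovChain.IsStationary (LoadBalancing.step service (arrival ε) (route ε)) π) ∧
    ∀ π : ℝ → PMF (Fin n → ℕ),
      (∀ ε ∈ Ioo 0 (LoadBalancing.totalRate service),
        MarkovChain.IsStationary (LoadBalancing.step service (arrival ε) (route ε)) (π ε)) →
      LoadBalancing.StateSpaceCollapse (LoadBalancing.totalRate service) π ∧
      LoadBalancing.FiniteMGF (LoadBalancing.totalRate service) π ∧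
      TendstoInDistribution
        (fun (ε : ℝ) (q : Fin n → ℕ) => ε • LoadBalancing.toVec q) (𝓝[>] 0)
        (fun t : ℝ => t • LoadBalancing.oneVec n)
        (fun ε => (π ε).toMeasure)
        (LoadBalancing.expLaw
          (1 / (2 * n) * (σa ^ 2 + ∑ i, ∑ j, LoadBalancing.serviceCov service i j))) := by
  have : Nonempty (Fin n) := ⟨⟨0, hn⟩⟩
  have hn' : (0 : ℝ) < n := by positivity
  obtain ⟨i₀, hi₀⟩ := Finite.exists_min (LoadBalancing.serviceRate service)
  set μ₀ := LoadBalancing.serviceRate service i₀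
  have hμ₀ : 0 < μ₀ := hrate i₀
  set T := LoadBalancing.totalRate service with hTdef
  have hT : 0 < T := Finset.sum_pos (fun i _ => hrate i) Finset.univ_nonempty
  constructor
  · intro ε hε
    obtain ⟨h1, h2, h3⟩ := LoadBalancing.drift_params hμ₀ hi₀ hε
    have hpr := LoadBalancing.isPositiveRecurrent_step hn hservice (harrival ε hε) (hroute ε hε)
      h1 h2 (by rw [hmean ε hε]; linarith)
    exact ⟨hpr, MarkovChain.exists_isStationary_of_isPositiveRecurrent hpr⟩
  intro π hπ
  set η₀ := LoadBalancing.expRate n Amax Smax μ₀ T with hη₀def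
  have hη₀ : 0 < η₀ := LoadBalancing.expRate_pos _ _ _ hμ₀ hT
  have hexp : ∀ ε ∈ Ioo 0 T, Integrable (fun q => Real.exp (η₀ * ε * ‖LoadBalancing.toVec q‖))
      (π ε).toMeasure := fun ε hε => LoadBalancing.integrable_exp_expRate hn hservice
    (harrival ε hε) (hroute ε hε) hμ₀ hi₀ hε (hmean ε hε) (hπ ε hε)
  have hsq : ∀ ε ∈ Ioo 0 T, Integrable (fun q => ‖LoadBalancing.toVec q‖ ^ 2) (π ε).toMeasure :=
    fun ε hε => LoadBalancing.integrable_norm_sq_of_exp (mul_pos hη₀ hε.1) (hexp ε hε)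
  have hperp : ∀ ε ∈ Ioo 0 T,
      Integrable (fun q => ‖LoadBalancing.perp (LoadBalancing.toVec q)‖ ^ 2) (π ε).toMeasure := by
    intro ε hε
    refine (hsq ε hε).mono' Measurable.of_discrete.aestronglyMeasurable (.of_forall fun q => ?_)
    rw [Real.norm_eq_abs, abs_of_nonneg (by positivity)]
    exact pow_le_pow_left₀ (norm_nonneg _) (LoadBalancing.norm_perp_le hn _) 2
  -- Here `δ = μ₀ / 2` is independent of `ε`, hence so is `b`; it is admissible once `ε ≤ n μ₀ / 2`.
  obtain ⟨b, hb0, hb⟩ := LoadBalancing.exists_cubic_bound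
    (LoadBalancing.jumpSq n Amax Smax) (μ₀ / 2) (LoadBalancing.jumpSq_nonneg _ _ _) (by positivity)
  have hsmall : ∀ᶠ ε in 𝓝[>] (0 : ℝ), ε ∈ Ioo 0 T ∧
      ∫ q, ‖LoadBalancing.perp (LoadBalancing.toVec q)‖ ^ 2 ∂(π ε).toMeasure ≤ b := by
    filter_upwards [Ioo_mem_nhdsGT hT, Ioo_mem_nhdsGT (show 0 < n * (μ₀ / 2) by positivity)]
      with ε hε hε'
    refine ⟨hε, (LoadBalancing.integral_norm_sq_perp_le (δ := μ₀ / 2) hn hservice (harrival ε hε)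
      (hroute ε hε) (by positivity) (fun j => ?_) ?_ (hπ ε hε) hb0 hb).2⟩
    · linarith [hi₀ j]
    · rw [hmean ε hε]; linarith [hε'.2]
  refine ⟨⟨hperp, ?_⟩, ?_, ?_⟩
  · refine Asymptotics.IsBigO.trans_isLittleO (g := fun _ : ℝ => (1 : ℝ)) ?_ ?_
    · refine Asymptotics.IsBigO.of_bound b (hsmall.mono fun ε hε => ?_)
      rw [Real.norm_eq_abs, abs_of_nonneg (integral_nonneg fun q => by positivity)]
      simpa using hε.2
    · rw [Asymptotics.isLittleO_const_left]
      right
      have h : Tendsto (fun ε : ℝ => ε⁻¹ ^ 2) (𝓝[>] 0) atTop :=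
        (tendsto_pow_atTop two_ne_zero).comp tendsto_inv_nhdsGT_zero
      refine tendsto_norm_atTop_atTop.comp (h.congr fun ε => ?_)
      simp
  · refine ⟨η₀ / n, by positivity, fun ε hε θ hθ => ?_⟩
    refine (hexp ε hε).mono' Measurable.of_discrete.aestronglyMeasurable (.of_forall fun q => ?_)
    rw [Real.norm_eq_abs, Real.abs_exp]
    refine Real.exp_le_exp.2 ?_
    have h1 := LoadBalancing.total_le_norm_toVec q
    have h2 := LoadBalancing.total_nonneg q
    calc θ * ε * LoadBalancing.total q ≤ η₀ / n * ε * (n * ‖LoadBalancing.toVec q‖) := by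
          have := hε.1
          have := hθ.2
          gcongr
      _ = _ := by field_simp
  · set v := σa ^ 2 + ∑ i, ∑ j, LoadBalancing.serviceCov service i j with hv
    have hv0 : 0 ≤ v := add_nonneg (sq_nonneg _) (LoadBalancing.sum_serviceCov_nonneg hservice)
    refine LoadBalancing.tendstoInDistribution_of_tendsto_phase (fun _ => .of_discrete)
      (by fun_prop) fun ξ => ?_
    set τ : ℝ := (∑ i, ξ i) / n with hτ
    have hlim : ∫ t, LoadBalancing.phase (inner ℝ (t • LoadBalancing.oneVec n) ξ)
        ∂(LoadBalancing.expLaw (1 / (2 * n) * v)) =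
        1 / (1 - Complex.I * ((n * τ : ℝ) : ℂ) * ((1 / (2 * n) * v : ℝ) : ℂ)) := by
      rw [← LoadBalancing.integral_phase_expLaw (by positivity)]
      congr 1; funext t
      congr 1
      rw [real_inner_smul_left, mul_comm, hτ]
      congr 1
      simp [LoadBalancing.oneVec, PiLp.inner_apply]
      field_simp
    rw [hlim]
    have hmain : Tendsto (fun ε => ∫ q, LoadBalancing.phase (τ * ε * LoadBalancing.total q)
        ∂(π ε).toMeasure) (𝓝[>] 0)
        (𝓝 (1 / (1 - Complex.I * ((n * τ : ℝ) : ℂ) * ((1 / (2 * n) * v : ℝ) : ℂ)))) := by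
      -- For `τ = 0` the limiting equation reads `0 = 0` and cannot be solved for the transform, but
      -- both sides of the claim are then `1`.
      by_cases hτ0 : τ = 0
      · simp [hτ0, LoadBalancing.phase]
      set d : ℝ → ℂ := fun ε => Complex.I * τ + ((τ ^ 2 / 2 *
        (LoadBalancing.arrivalStd (arrival ε) ^ 2 +
          ∑ i, ∑ j, LoadBalancing.serviceCov service i j + ε ^ 2) : ℝ) : ℂ) with hd
      have hε0 : Tendsto (fun ε : ℝ => ε) (𝓝[>] 0) (𝓝 0) := tendsto_nhdsWithin_of_tendsto_nhds
        tendsto_id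
      have hdlim : Tendsto d (𝓝[>] 0) (𝓝 (Complex.I * τ + ((τ ^ 2 / 2 * v : ℝ) : ℂ))) := by
        refine tendsto_const_nhds.add ((Complex.continuous_ofReal.tendsto _).comp
          (Tendsto.const_mul _ ?_))
        have := (((hσa.pow 2).add_const (∑ i, ∑ j, LoadBalancing.serviceCov service i j))).add
          (hε0.pow 2)
        simpa [hv] using this
      -- The imaginary part is `τ`; this also covers `v = 0`.
      have hd0 : Complex.I * τ + ((τ ^ 2 / 2 * v : ℝ) : ℂ) ≠ 0 := fun h => hτ0 (by
        simpa [-Complex.ofReal_mul, -Complex.ofReal_div, -Complex.ofReal_pow]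
          using congrArg Complex.im h)
      have he : Tendsto (fun ε : ℝ => τ ^ 2 * (n * Smax * ε + n * (n * Smax * b + 1) * √ε) +
          (|τ| * (Amax + n * Smax)) ^ 3 * ε) (𝓝[>] 0) (𝓝 0) := by
        have hc : Continuous fun ε : ℝ => τ ^ 2 * (n * Smax * ε + n * (n * Smax * b + 1) * √ε) +
          (|τ| * (Amax + n * Smax)) ^ 3 * ε := by fun_prop
        simpa using (hc.tendsto 0).mono_left nhdsWithin_le_nhds
      have hτε : ∀ᶠ ε in 𝓝[>] (0 : ℝ), |τ| * ε * (Amax + n * Smax) ≤ 1 := by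
        have hc : Continuous fun ε : ℝ => |τ| * ε * (Amax + n * Smax) := by fun_prop
        have := (hc.tendsto 0).mono_left (nhdsWithin_le_nhds (s := Ioi 0))
        exact (this.eventually_lt_const (by simp)).mono fun _ h => h.le
      have h := LoadBalancing.tendsto_of_mul_tendsto (c := Complex.I * τ)
        (fun ε => LoadBalancing.norm_integral_phase_le (μ := (π ε).toMeasure)
          fun q => τ * ε * LoadBalancing.total q) hdlim hd0 he (by
        filter_upwards [hsmall, hτε] with ε hε hε'
        exact LoadBalancing.norm_integral_phase_mul_sub_le hn hservice (harrival ε hε.1)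
          (hπ ε hε.1) (LoadBalancing.integrable_total_of_norm_sq (hsq ε hε.1)) hε.1.1
          (hmean ε hε.1) (hperp ε hε.1) hε.2 hε')
      have heq : Complex.I * τ / (Complex.I * τ + ((τ ^ 2 / 2 * v : ℝ) : ℂ)) =
          1 / (1 - Complex.I * ((n * τ : ℝ) : ℂ) * ((1 / (2 * n) * v : ℝ) : ℂ)) := by
        have hnC : (n : ℂ) ≠ 0 := by exact_mod_cast hn.ne'
        have hτC : (τ : ℂ) ≠ 0 := by exact_mod_cast hτ0
        have h1 : Complex.I * τ + ((τ ^ 2 / 2 * v : ℝ) : ℂ) = Complex.I * τ *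
            (1 - Complex.I * ((n * τ : ℝ) : ℂ) * ((1 / (2 * n) * v : ℝ) : ℂ)) := by
          push_cast
          field_simp
          linear_combination (τ * v : ℂ) * Complex.I_sq
        rw [h1, div_mul_eq_div_div, div_self (mul_ne_zero Complex.I_ne_zero hτC)]
      rwa [heq] at h
    have hdiff : Tendsto (fun ε => ∫ q, LoadBalancing.phase
        (inner ℝ (ε • LoadBalancing.toVec q) ξ) ∂(π ε).toMeasure -
        ∫ q, LoadBalancing.phase (τ * ε * LoadBalancing.total q) ∂(π ε).toMeasure)
        (𝓝[>] 0) (𝓝 0) := by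
      refine squeeze_zero_norm' (a := fun ε => ε * (‖ξ‖ * (1 + b))) ?_ ?_
      · filter_upwards [hsmall] with ε hε
        exact LoadBalancing.norm_integral_phase_inner_sub_le hn (hperp ε hε.1) hε.1.1.le hε.2 ξ
      · have hc : Continuous fun ε : ℝ => ε * (‖ξ‖ * (1 + b)) := by fun_prop
        simpa using (hc.tendsto 0).mono_left (nhdsWithin_le_nhds (s := Ioi 0))
    simpa using hdiff.add hmain
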